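/- Let $N\ge 1$. For $\theta,\phi\in\mathbb R$ let $$M(\theta,\phi)=\begin{pmatrix}e^{i\phi}&0\\0&1\end{pmatrix}B\begin{pmatrix}e^{i\theta}&0\\0&1\end{pmatrix}B,\qquad B=\tfrac1{\sqrt2}\begin{pmatrix}1&i\\ i&1\end{pmatrix},$$ be the matrix of a Mach–Zehnder interferometer, with transmissivity $t=\cos^2(\theta/2)$, and for $1\le n\le N-1$ let $U_n(\theta,\phi)$ be the $N\times N$ unitary matrix that acts as $M(\theta,\phi)$ on the coordinates $n,n+1$ and as the identity on the others. Given phases $\gamma_1,\dots,\gamma_N$ and, for all $1\le m\le N$ and $N-m+1\le n\le N-1$, phases $\theta^{(m)}_n,\phi^{(m)}_n$, the triangular mesh is the unitary matrix $$U_{\mathrm T}(\gamma,\theta,\phi)=U^{(N)}U^{(N-1)}\cdots U^{(1)},\qquad U^{(m)}=U_{N-1}\bigl(\theta^{(m)}_{N-1},\phi^{(m)}_{N-1}\bigr)\,U_{N-2}\bigl(\theta^{(m)}_{N-2},\phi^{(m)}_{N-2}\bigr)\cdots U_{N-m+1}\bigl(\theta^{(m)}_{N-m+1},\phi^{(m)}_{N-m+1}\bigr)\,D_m(\gamma_{N-m+1}),$$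 where $D_m(\gamma)$ is diagonal with entry $e^{i\gamma}$ at position $N-m+1$ and $1$ elsewhere. The parameters range over the domain $\gamma,\phi\in[0,2\pi)$, $\theta\in[0,\pi]$. The sensitivity index of the interferometer at waveguide $n$ (in any layer) is $\alpha=N-n$. (1) Every $U\in\mathrm U(N)$ equals $U_{\mathrm T}(\gamma,\theta,\phi)$ for some parameters in the domain, and for almost every $U$ with respect to the Haar probability measure $\mu$ of $\mathrm U(N)$ these parameters are unique. (2) The Haar measure factorizes in these coordinates: $\mu$ is the image under $U_{\mathrm T}$ (a measurable map) of the product probability measure under which all parameters are independent, every $\gamma_n$ and every $\phi^{(m)}_n$ is uniform on $[0,2\pi)$, and every transmissivity $t^{(m)}_n=\cos^2(\theta^{(m)}_n/2)$ has density $\mathcal Q_\alpha(t)=\alpha t^{\alpha-1}$ on $[0,1]$ with $\alpha=N-n$ (that is, $\theta=2\arccos\sqrt t$); equivalently, every $\theta^{(m)}_n$ has density $\mathcal P_\alpha(\theta/2)=\alpha\sin(\theta/2)\cos^{2\alpha-1}(\theta/2)$ with respect to $d\theta$ on $[0,\pi]$. (3) Conversely, let $c$ be any map that assigns to $\mu$-almost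 every $U\in\mathrm U(N)$ parameters in the domain with $U_{\mathrm T}(c(U))=U$. Then $c$ is $\mu$-measurable, and for $\mu$-distributed $U$ the parameters $c(U)$ are jointly independent, with all $\gamma_n,\phi^{(m)}_n$ uniform on $[0,2\pi)$ and, with $\alpha=N-n$: $\theta^{(m)}_n$ has density $\alpha\sin(\theta/2)\cos^{2\alpha-1}(\theta/2)$ on $[0,\pi]$; $t^{(m)}_n$ has density $\alpha t^{\alpha-1}$ on $[0,1]$; $x=\theta^{(m)}_n/2$ has density $2\alpha\sin x\cos^{2\alpha-1}x$ with respect to $dx$ on $[0,\pi/2]$; and the Haar phase $\xi^{(m)}_n=(t^{(m)}_n)^{\alpha}$ is uniform on $[0,1]$. (4) The Haar phase is the cumulative distribution function: for $\alpha=N-n$, $1\le n\le N-1$, one has $\int_0^t\mathcal Q_\alpha(s)\,ds=t^\alpha$ for $t\in[0,1]$, and $\int_\theta^\pi\mathcal P_\alpha(s/2)\,ds=\cos^{2\alpha}(\theta/2)=\xi$ for $\theta\in[0,\pi]$. -/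

import Mathlib

open MeasureTheory

namespace TriangularMesh

noncomputable section

/-! ### The unitary group and its Haar probability measure -/

/-- The group `U(N)`. -/
abbrev UnitaryN (N : ℕ) : Type := Matrix.unitaryGroup (Fin N) ℂ

instance instMeasurableSpaceUnitaryN (N : ℕ) : MeasurableSpace (UnitaryN N) := borel _

instance instBorelSpaceUnitaryN (N : ℕ) : BorelSpace (UnitaryN N) := ⟨rfl⟩

instance instCompactSpaceUnitaryN (N : ℕ) : CompactSpace (UnitaryN N) := by
  refine isCompact_iff_compactSpace.mp ?_
  have hK : IsCompact (Set.univ.pi fun _ : Fin N => Set.univ.pi fun _ : Fin N =>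
      Metric.closedBall (0 : ℂ) 1) :=
    isCompact_univ_pi fun _ => isCompact_univ_pi fun _ => isCompact_closedBall _ _
  refine hK.of_isClosed_subset (isClosed_unitary (R := Matrix (Fin N) (Fin N) ℂ)) ?_
  intro U hU i _ j _
  simpa using entry_norm_bound_of_unitary (𝕜 := ℂ) hU i j

/-- The Haar measure of `U(N)`, normalized to total mass one. -/
def haarU (N : ℕ) : Measure (UnitaryN N) := Measure.haarMeasure ⊤

/-! ### Mach-Zehnder interferometers -/

/-- Phase shift `e^{iφ}` on the upper arm. -/
def upperPhase (φ : ℝ) : Matrix (Fin 2) (Fin 2) ℂ :=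
  !![Complex.exp (Complex.I * φ), 0; 0, 1]

/-- The 50:50 beamsplitter. -/
def beamsplitter : Matrix (Fin 2) (Fin 2) ℂ :=
  ((Real.sqrt 2 : ℝ) : ℂ)⁻¹ • !![1, Complex.I; Complex.I, 1]

/-- The interferometer `R_φ B R_θ B`. -/
def mziBlock (θ φ : ℝ) : Matrix (Fin 2) (Fin 2) ℂ :=
  upperPhase φ * beamsplitter * upperPhase θ * beamsplitter

/-- The transmissivity `cos² (θ / 2)` of an interferometer. -/
def transmissivity (θ : ℝ) : ℝ := Real.cos (θ / 2) ^ 2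

/-- The `N × N` matrix that acts as the `2 × 2` matrix `A` on the modes `a`, `b`
and as the identity on all others. -/
def givens {N : ℕ} (a b : Fin N) (A : Matrix (Fin 2) (Fin 2) ℂ) : Matrix (Fin N) (Fin N) ℂ :=
  Matrix.of fun i j =>
    if i = a ∧ j = a then A 0 0
    else if i = a ∧ j = b then A 0 1
    else if i = b ∧ j = a then A 1 0
    else if i = b ∧ j = b then A 1 1
    else if i = j then 1 else 0

/-- The phase shift `e^{iγ}` on the single mode `a`. -/
def modePhase {N : ℕ} (a : Fin N) (γ : ℝ) : Matrix (Fin N) (Fin N) ℂ :=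
  Matrix.diagonal fun i => if i = a then Complex.exp (Complex.I * γ) else 1

/-! ### The triangular mesh

Counting from one, the mesh has diagonal layers `m = 1, …, N`, and layer `m` contains the
interferometers `U_{N-1}, U_{N-2}, …, U_{N-m+1}`, where `U_n` couples the waveguides
`n` and `n + 1`. In Lean the layer `m` is the element `m - 1` of `Fin N`, the waveguide `n` is
the element `n - 1` of `Fin N`, and the interferometer `U_{N-k}` of layer `m` (`1 ≤ k ≤ m - 1`)
is the element `⟨m - 1, k - 1⟩` of `MZI N`. -/

/-- Positions of the interferometers of the triangular mesh. -/
abbrev MZI (N : ℕ) : Type := Σ m : Fin N, Fin m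

/-- The upper of the two modes that an interferometer couples. -/
def upperMode {N : ℕ} (p : MZI N) : Fin N := Fin.rev ⟨p.2 + 1, by omega⟩

/-- The lower of the two modes that an interferometer couples. -/
def lowerMode {N : ℕ} (p : MZI N) : Fin N := Fin.rev ⟨p.2, by omega⟩

/-- The waveguide index `n ∈ {1, …, N - 1}` of an interferometer, counted from one. -/
def waveguide {N : ℕ} (p : MZI N) : ℕ := (upperMode p : ℕ) + 1

/-- The sensitivity index `α = N - n`. -/
def sensitivity {N : ℕ} (p : MZI N) : ℕ := N - waveguide p

/-- Mesh parameters `(γ, x, φ)`: the phases `γ` of the modes, one internal parameter `x` for every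
interferometer (`θ`, `θ / 2`, the transmissivity or the Haar phase) and the phases `φ` of the
interferometers. -/
abbrev Params (N : ℕ) : Type := (Fin N → ℝ) × (MZI N → ℝ) × (MZI N → ℝ)

/-- The operator of one diagonal layer,
`U^{(m)} = U_{N-1} U_{N-2} ⋯ U_{N-m+1} D_m(γ_{N-m+1})`, where `D_m` shifts the mode `N - m + 1`. -/
def layerMatrix {N : ℕ} (q : Params N) (m : Fin N) : Matrix (Fin N) (Fin N) ℂ :=
  (List.ofFn fun k : Fin m =>
      givens (upperMode ⟨m, k⟩) (lowerMode ⟨m, k⟩) (mziBlock (q.2.1 ⟨m, k⟩) (q.2.2 ⟨m, k⟩))).prod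
    * modePhase (Fin.rev m) (q.1 (Fin.rev m))

/-- The mesh operator `U^{(N)} U^{(N-1)} ⋯ U^{(1)}`. -/
def meshMatrix {N : ℕ} (q : Params N) : Matrix (Fin N) (Fin N) ℂ :=
  (List.ofFn fun i : Fin N => layerMatrix q (Fin.rev i)).prod

/-! ### The mesh operator is unitary -/

lemma upperPhase_mem (φ : ℝ) : upperPhase φ ∈ Matrix.unitaryGroup (Fin 2) ℂ := by
  have h : Complex.exp (Complex.I * φ) * (starRingEnd ℂ) (Complex.exp (Complex.I * φ)) = 1 := by
    rw [← Complex.exp_conj, ← Complex.exp_add]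
    simp
  rw [Matrix.mem_unitaryGroup_iff]
  ext i j
  fin_cases i <;> fin_cases j <;>
    simp [upperPhase, Matrix.mul_apply, Fin.sum_univ_two, Matrix.star_apply, h]

lemma beamsplitter_mem : beamsplitter ∈ Matrix.unitaryGroup (Fin 2) ℂ := by
  have h : ((Real.sqrt 2 : ℝ) : ℂ)⁻¹ * ((Real.sqrt 2 : ℝ) : ℂ)⁻¹ = 1 / 2 := by
    rw [← mul_inv, ← Complex.ofReal_mul, Real.mul_self_sqrt (by norm_num)]
    norm_num
  rw [Matrix.mem_unitaryGroup_iff]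
  ext i j
  fin_cases i <;> fin_cases j <;>
    simp [beamsplitter, Matrix.mul_apply, Fin.sum_univ_two, Matrix.star_apply] <;>
    first
      | ring1
      | linear_combination 2 * h - ((Real.sqrt 2 : ℝ) : ℂ)⁻¹ ^ 2 * Complex.I_sq

lemma mziBlock_mem (θ φ : ℝ) : mziBlock θ φ ∈ Matrix.unitaryGroup (Fin 2) ℂ :=
  mul_mem (mul_mem (mul_mem (upperPhase_mem φ) beamsplitter_mem) (upperPhase_mem θ))
    beamsplitter_mem

lemma modePhase_mem {N : ℕ} (a : Fin N) (γ : ℝ) :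
    modePhase a γ ∈ Matrix.unitaryGroup (Fin N) ℂ := by
  have h : Complex.exp (Complex.I * γ) * (starRingEnd ℂ) (Complex.exp (Complex.I * γ)) = 1 := by
    rw [← Complex.exp_conj, ← Complex.exp_add]
    simp
  rw [Matrix.mem_unitaryGroup_iff, modePhase, Matrix.star_eq_conjTranspose,
    Matrix.diagonal_conjTranspose, Matrix.diagonal_mul_diagonal, ← Matrix.diagonal_one]
  congr 1
  funext i
  by_cases hi : i = a <;> simp [hi, h]

lemma givens_mem {N : ℕ} {a b : Fin N} (hab : a ≠ b) {A : Matrix (Fin 2) (Fin 2) ℂ}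
    (hA : A ∈ Matrix.unitaryGroup (Fin 2) ℂ) :
    givens a b A ∈ Matrix.unitaryGroup (Fin N) ℂ := by
  let E : Matrix (Fin N) (Fin 2) ℂ := Matrix.of fun i k => if i = ![a, b] k then 1 else 0
  have hE : E.conjTranspose * E = 1 := by
    ext k l
    rw [Matrix.mul_apply, Finset.sum_eq_single (![a, b] l)]
    · fin_cases k <;> fin_cases l <;> simp [E, hab, hab.symm]
    · intro j _ hj
      simp [E, hj]
    · simp
  have hG : givens a b A = 1 + E * (A - 1) * E.conjTranspose := by
    ext i j
    by_cases hia : i = a <;> by_cases hja : j = a <;> by_cases hib : i = b <;>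
      by_cases hjb : j = b <;>
      simp_all [givens, E, Matrix.mul_apply, Fin.sum_univ_two, Matrix.one_apply]
  have hA' : A * A.conjTranspose = 1 := by
    simpa [Matrix.star_eq_conjTranspose] using Matrix.mem_unitaryGroup_iff.mp hA
  rw [Matrix.mem_unitaryGroup_iff, Matrix.star_eq_conjTranspose, hG]
  have hC : (1 + E * (A - 1) * E.conjTranspose).conjTranspose
      = 1 + E * (A.conjTranspose - 1) * E.conjTranspose := by
    simp [Matrix.conjTranspose_mul, Matrix.mul_assoc]
  have hM : E * (A - 1) * E.conjTranspose * (E * (A.conjTranspose - 1) * E.conjTranspose)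
      = E * ((A - 1) * (A.conjTranspose - 1)) * E.conjTranspose := by
    calc _ = E * (A - 1) * (E.conjTranspose * E) * (A.conjTranspose - 1) * E.conjTranspose := by
          simp only [Matrix.mul_assoc]
      _ = _ := by rw [hE]; simp only [Matrix.mul_assoc, Matrix.one_mul]
  have hB : (A - 1) * (A.conjTranspose - 1) = -(A - 1) - (A.conjTranspose - 1) := by
    rw [sub_mul, mul_sub, hA']
    simp
  rw [hC, add_mul, mul_add, mul_add, hM, hB]
  simp only [Matrix.mul_sub, Matrix.sub_mul, Matrix.mul_neg, Matrix.neg_mul, one_mul, mul_one]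
  abel

lemma upperMode_ne_lowerMode {N : ℕ} (p : MZI N) : upperMode p ≠ lowerMode p := by
  simp [upperMode, lowerMode]

lemma layerMatrix_mem {N : ℕ} (q : Params N) (m : Fin N) :
    layerMatrix q m ∈ Matrix.unitaryGroup (Fin N) ℂ := by
  refine mul_mem (list_prod_mem ?_) (modePhase_mem _ _)
  intro x hx
  obtain ⟨k, rfl⟩ := (List.mem_ofFn' _ _).mp hx
  exact givens_mem (upperMode_ne_lowerMode _) (mziBlock_mem _ _)

lemma meshMatrix_mem {N : ℕ} (q : Params N) :
    meshMatrix q ∈ Matrix.unitaryGroup (Fin N) ℂ := by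
  refine list_prod_mem ?_
  intro x hx
  obtain ⟨k, rfl⟩ := (List.mem_ofFn' _ _).mp hx
  exact layerMatrix_mem _ _

/-- The unitary operator realized by the triangular mesh with phases `(γ, θ, φ)`. -/
def mesh {N : ℕ} (q : Params N) : UnitaryN N := ⟨meshMatrix q, meshMatrix_mem q⟩

/-- The parameter domain `γ, φ ∈ [0, 2π)`, `θ ∈ [0, π]`. -/
def paramDomain (N : ℕ) : Set (Params N) :=
  {q | (∀ n, q.1 n ∈ Set.Ico 0 (2 * Real.pi)) ∧ (∀ p, q.2.1 p ∈ Set.Icc 0 Real.pi) ∧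
    ∀ p, q.2.2 p ∈ Set.Ico 0 (2 * Real.pi)}

/-- Change of the internal parameters, depending on the sensitivity index. -/
def mapInternal {N : ℕ} (f : ℕ → ℝ → ℝ) (q : Params N) : Params N :=
  (q.1, fun p => f (sensitivity p) (q.2.1 p), q.2.2)

/-- The Haar phase `ξ = t ^ α` as a function of `θ`. -/
def haarPhase (α : ℕ) (θ : ℝ) : ℝ := transmissivity θ ^ α

/-! ### Probability laws -/

/-- The uniform distribution on `[0, 2π)`. -/
def uniformPhase : Measure ℝ := ProbabilityTheory.cond volume (Set.Ico 0 (2 * Real.pi))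

/-- The uniform distribution on `[0, 1]`. -/
def uniformUnit : Measure ℝ := ProbabilityTheory.cond volume (Set.Icc 0 1)

/-- The density of a transmissivity. -/
def densityT (α : ℕ) (t : ℝ) : ℝ := α * t ^ (α - 1)

/-- The density of `θ` with respect to `dθ`. -/
def densityTheta (α : ℕ) (θ : ℝ) : ℝ := α * Real.sin (θ / 2) * Real.cos (θ / 2) ^ (2 * α - 1)

/-- The law on `[0, 1]` with density `α t ^ (α - 1)`. -/
def lawT (α : ℕ) : Measure ℝ :=
  (volume.restrict (Set.Icc 0 1)).withDensity fun t => ENNReal.ofReal (densityT α t)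

/-- The law on `[0, π]` with density `α sin (θ / 2) cos ^ (2 α - 1) (θ / 2)`. -/
def lawTheta (α : ℕ) : Measure ℝ :=
  (volume.restrict (Set.Icc 0 Real.pi)).withDensity fun θ => ENNReal.ofReal (densityTheta α θ)

/-- The law on `[0, π / 2]` with density `2 α sin x cos ^ (2 α - 1) x`. -/
def lawHalfTheta (α : ℕ) : Measure ℝ :=
  (volume.restrict (Set.Icc 0 (Real.pi / 2))).withDensity fun x =>
    ENNReal.ofReal (2 * α * Real.sin x * Real.cos x ^ (2 * α - 1))

/-- The law of mesh parameters under which all coordinates are independent, the phases `γ` and `φ`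
are uniform on `[0, 2π)`, and the internal parameter of an interferometer with sensitivity index
`α` has law `ν α`. -/
def productLaw (N : ℕ) (ν : ℕ → Measure ℝ) : Measure (Params N) :=
  (Measure.pi fun _ => uniformPhase).prod
    ((Measure.pi fun p => ν (sensitivity p)).prod (Measure.pi fun _ => uniformPhase))

end

end TriangularMesh

open MeasureTheory

namespace TriangularMesh

noncomputable section

/-! ### Block embedding of `U(N)` into `U(N + 1)` -/

/-! The mesh is a recursion over the dimension. In `N + 1` modes only the leftmost layer `L` touches
mode `0`, so a mesh operator is `L * (1 ⊕ V)` with `V` a mesh operator in `N` modes (`mesh_succ`).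
Its first column is that of `L`, and two unitaries with equal first columns differ by a right factor
`1 ⊕ W`. Everything thus reduces to the first column of one layer, a point of the unit sphere.

That column is built by repeated splitting (`layerColumn_succ`): its first entry has modulus `sin (θ
/ 2)`, and its tail is `cos (θ / 2)` times, up to a phase, the column of a shorter layer. Solving
for one interferometer at a time realizes every unit vector, uniquely when every `θ` lies in the
open interval `(0, π)` (`exists_layerColumn_eq`, `layerColumn_inj`). Induction gives existence and
generic uniqueness for the mesh.

For the measure, the squared moduli of a standard complex Gaussian vector are independent
exponentials, with independent uniform phases. A Gamma variable of shape `α + 1`, multiplied by an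
independent `t` of density `α t ^ (α - 1)`, splits into independent Gamma variables of shapes `α`
and `1`. Iterating the split shows that a Gamma radius times the random layer column is Gaussian
(`lintegral_gaussLaw_eq`). Gaussian vectors are unitarily invariant, hence so is the law of the
column, and it must be the law of a Haar first column (`lintegral_firstColumn`). Averaging over the
subgroup `1 ⊕ U(N)` factorizes Haar measure into a random layer and a Haar element of `U(N)`
(`lintegral_haarU_succ`), and induction gives `map_mesh`.

Conversely, the mesh is injective on a set of full measure, so it has a measurable left inverse
there. Any choice of coordinates agrees with this inverse almost everywhere and inherits the product
law (`map_coordinates`); the other internal parameters follow by one-dimensional changes of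
variables. -/

/-- The block diagonal matrix `1 ⊕ A`. -/
def embedMatrix {N : ℕ} (A : Matrix (Fin N) (Fin N) ℂ) : Matrix (Fin (N + 1)) (Fin (N + 1)) ℂ :=
  Matrix.of (Fin.cons (Fin.cons 1 0) fun i => Fin.cons 0 (A i))

section embedMatrix

variable {N : ℕ} (A : Matrix (Fin N) (Fin N) ℂ)

@[simp] lemma embedMatrix_zero_zero : embedMatrix A 0 0 = 1 := rfl

@[simp] lemma embedMatrix_zero_succ (j : Fin N) : embedMatrix A 0 j.succ = 0 := rfl

@[simp] lemma embedMatrix_succ_zero (i : Fin N) : embedMatrix A i.succ 0 = 0 := rfl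

@[simp] lemma embedMatrix_succ_succ (i j : Fin N) : embedMatrix A i.succ j.succ = A i j := rfl

lemma embedMatrix_one : embedMatrix (1 : Matrix (Fin N) (Fin N) ℂ) = 1 := by
  ext i j
  refine Fin.cases ?_ (fun i => ?_) i <;> refine Fin.cases ?_ (fun j => ?_) j <;>
    simp [Matrix.one_apply]
  exact (Fin.succ_ne_zero _).symm

lemma embedMatrix_mul (B : Matrix (Fin N) (Fin N) ℂ) :
    embedMatrix (A * B) = embedMatrix A * embedMatrix B := by
  ext i j
  refine Fin.cases ?_ (fun i => ?_) i <;> refine Fin.cases ?_ (fun j => ?_) j <;>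
    simp [Matrix.mul_apply, Fin.sum_univ_succ]

lemma embedMatrix_star : embedMatrix (star A) = star (embedMatrix A) := by
  ext i j
  refine Fin.cases ?_ (fun i => ?_) i <;> refine Fin.cases ?_ (fun j => ?_) j <;>
    simp [Matrix.star_apply]

lemma embedMatrix_mulVec (w : ℂ) (v : Fin N → ℂ) :
    Matrix.mulVec (embedMatrix A) (Fin.cons w v) = Fin.cons w (Matrix.mulVec A v) := by
  ext i
  refine Fin.cases ?_ (fun i => ?_) i <;>
    simp [Matrix.mulVec, dotProduct, Fin.sum_univ_succ]

lemma embedMatrix_injective :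
    Function.Injective (embedMatrix : Matrix (Fin N) (Fin N) ℂ → _) := by
  intro A B h
  ext i j
  simpa using congrFun (congrFun h i.succ) j.succ

lemma continuous_embedMatrix :
    Continuous (embedMatrix : Matrix (Fin N) (Fin N) ℂ → _) := by
  refine continuous_matrix fun i j => ?_
  refine Fin.cases ?_ (fun i => ?_) i <;> refine Fin.cases ?_ (fun j => ?_) j <;>
    simp only [embedMatrix_zero_zero, embedMatrix_zero_succ, embedMatrix_succ_zero,
      embedMatrix_succ_succ]
  · exact continuous_const
  · exact continuous_const
  · exact continuous_const
  · exact continuous_id.matrix_elem i j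

end embedMatrix

/-- `embedMatrix` as a monoid homomorphism. -/
def embedMatrixHom (N : ℕ) :
    Matrix (Fin N) (Fin N) ℂ →* Matrix (Fin (N + 1)) (Fin (N + 1)) ℂ where
  toFun := embedMatrix
  map_one' := embedMatrix_one
  map_mul' := embedMatrix_mul

/-- The subgroup embedding `A ↦ 1 ⊕ A` of `U(N)` into `U(N + 1)`. -/
def embedUnitary {N : ℕ} (U : UnitaryN N) : UnitaryN (N + 1) :=
  ⟨embedMatrix U, by
    rw [Matrix.mem_unitaryGroup_iff, ← embedMatrix_star, ← embedMatrix_mul,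
      Matrix.mem_unitaryGroup_iff.mp U.2, embedMatrix_one]⟩

@[simp] lemma coe_embedUnitary {N : ℕ} (U : UnitaryN N) :
    (embedUnitary U : Matrix (Fin (N + 1)) (Fin (N + 1)) ℂ) = embedMatrix U := rfl

lemma embedUnitary_mul {N : ℕ} (U V : UnitaryN N) :
    embedUnitary (U * V) = embedUnitary U * embedUnitary V :=
  Subtype.ext (embedMatrix_mul _ _)

lemma embedUnitary_injective {N : ℕ} :
    Function.Injective (embedUnitary : UnitaryN N → UnitaryN (N + 1)) := fun _ _ h =>
  Subtype.ext (embedMatrix_injective (congrArg Subtype.val h))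

lemma continuous_embedUnitary {N : ℕ} :
    Continuous (embedUnitary : UnitaryN N → UnitaryN (N + 1)) :=
  (continuous_embedMatrix.comp continuous_subtype_val).subtype_mk _

/-- Interferometers that avoid mode `0` lie in the embedded block; this is what identifies the lower
layers with a smaller mesh. -/
lemma givens_succ_succ {N : ℕ} (a b : Fin N) (A : Matrix (Fin 2) (Fin 2) ℂ) :
    givens a.succ b.succ A = embedMatrix (givens a b A) := by
  ext i j
  refine Fin.cases ?_ (fun i => ?_) i <;> refine Fin.cases ?_ (fun j => ?_) j
  · simp [givens, (Fin.succ_ne_zero _).symm]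
  · simp [givens, (Fin.succ_ne_zero _).symm]
  · simp [givens, (Fin.succ_ne_zero _).symm]
  · simp [givens]

lemma modePhase_succ {N : ℕ} (a : Fin N) (γ : ℝ) :
    modePhase a.succ γ = embedMatrix (modePhase a γ) := by
  ext i j
  refine Fin.cases ?_ (fun i => ?_) i <;> refine Fin.cases ?_ (fun j => ?_) j
  · simp [modePhase, (Fin.succ_ne_zero _).symm]
  · simp [modePhase, (Fin.succ_ne_zero _).symm]
  · simp [modePhase]
  · simp [modePhase, Matrix.diagonal_apply]

/-! ### The first column of a unitary matrix -/

/-- The first column of a unitary matrix. -/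
def firstColumn {N : ℕ} (U : UnitaryN (N + 1)) : Fin (N + 1) → ℂ :=
  Matrix.mulVec (U : Matrix (Fin (N + 1)) (Fin (N + 1)) ℂ) (Fin.cons 1 0)

lemma firstColumn_mul {N : ℕ} (U V : UnitaryN (N + 1)) :
    firstColumn (U * V)
      = Matrix.mulVec (U : Matrix (Fin (N + 1)) (Fin (N + 1)) ℂ) (firstColumn V) := by
  simp [firstColumn, Matrix.mulVec_mulVec]

lemma firstColumn_apply {N : ℕ} (U : UnitaryN (N + 1)) (i : Fin (N + 1)) :
    firstColumn U i = (U : Matrix (Fin (N + 1)) (Fin (N + 1)) ℂ) i 0 := by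
  simp [firstColumn, Matrix.mulVec, dotProduct, Fin.sum_univ_succ]

/-- The factor `1 ⊕ V` fixes the first basis vector, so the first column sees only the last layer of
a mesh. -/
lemma firstColumn_mul_embedUnitary {N : ℕ} (U : UnitaryN (N + 1)) (V : UnitaryN N) :
    firstColumn (U * embedUnitary V) = firstColumn U := by
  rw [firstColumn_mul, firstColumn, firstColumn, coe_embedUnitary, embedMatrix_mulVec,
    Matrix.mulVec_zero]

lemma continuous_firstColumn {N : ℕ} :
    Continuous (firstColumn : UnitaryN (N + 1) → Fin (N + 1) → ℂ) :=
  continuous_subtype_val.matrix_mulVec continuous_const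

lemma sum_normSq_mulVec {N : ℕ} (U : UnitaryN N) (v : Fin N → ℂ) :
    ∑ i, Complex.normSq (Matrix.mulVec (U : Matrix (Fin N) (Fin N) ℂ) v i)
      = ∑ i, Complex.normSq (v i) := by
  have key : ∀ w : Fin N → ℂ, ((∑ i, Complex.normSq (w i) : ℝ) : ℂ) = star w ⬝ᵥ w := by
    intro w
    simp [dotProduct, Complex.normSq_eq_conj_mul_self]
  have hU : (U : Matrix (Fin N) (Fin N) ℂ).conjTranspose * U = 1 := by
    simpa [Matrix.star_eq_conjTranspose] using Matrix.mem_unitaryGroup_iff'.mp U.2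
  apply Complex.ofReal_injective
  rw [key, key, Matrix.star_mulVec, Matrix.dotProduct_mulVec, Matrix.vecMul_vecMul, hU,
    Matrix.vecMul_one]

lemma sum_normSq_firstColumn {N : ℕ} (U : UnitaryN (N + 1)) :
    ∑ i, Complex.normSq (firstColumn U i) = 1 := by
  rw [firstColumn, sum_normSq_mulVec]
  simp [Fin.sum_univ_succ]

/-- A unitary matrix fixing the first basis vector comes from the block embedding. -/
lemma exists_embedUnitary_of_firstColumn {N : ℕ} (U : UnitaryN (N + 1))
    (hU : firstColumn U = Fin.cons 1 0) : ∃ V : UnitaryN N, embedUnitary V = U := by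
  have h0 : (U : Matrix (Fin (N + 1)) (Fin (N + 1)) ℂ) 0 0 = 1 := by
    rw [← firstColumn_apply, hU]; rfl
  have hs : ∀ i : Fin N, (U : Matrix (Fin (N + 1)) (Fin (N + 1)) ℂ) i.succ 0 = 0 := by
    intro i; rw [← firstColumn_apply, hU]; rfl
  -- The inverse fixes the same vector, and its first column is the conjugate of the first row of
  -- `U`; hence that row vanishes off the diagonal.
  have hinv : firstColumn U⁻¹ = Fin.cons 1 0 := by
    have : firstColumn (U⁻¹ * U) = Matrix.mulVec (U⁻¹ : UnitaryN (N + 1)).1 (Fin.cons 1 0) := by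
      rw [firstColumn_mul, hU]
    rw [inv_mul_cancel] at this
    rw [firstColumn, ← this]
    simp [firstColumn]
  have hr : ∀ j : Fin N, (U : Matrix (Fin (N + 1)) (Fin (N + 1)) ℂ) 0 j.succ = 0 := by
    intro j
    have h := congrFun hinv j.succ
    rw [firstColumn_apply] at h
    have h' : star ((U : Matrix (Fin (N + 1)) (Fin (N + 1)) ℂ) 0 j.succ) = 0 := by
      simpa [Matrix.star_apply] using h
    simpa using h'
  let A : Matrix (Fin N) (Fin N) ℂ := Matrix.of fun i j => U.1 i.succ j.succ
  have hA : embedMatrix A = U := by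
    ext i j
    refine Fin.cases ?_ (fun i => ?_) i <;> refine Fin.cases ?_ (fun j => ?_) j
    · simp [h0]
    · simp [hr]
    · simp [hs]
    · simp [A]
  refine ⟨⟨A, ?_⟩, Subtype.ext hA⟩
  rw [Matrix.mem_unitaryGroup_iff]
  apply embedMatrix_injective
  rw [embedMatrix_mul, embedMatrix_star, hA, embedMatrix_one]
  exact Matrix.mem_unitaryGroup_iff.mp U.2

/-- The fibres of `firstColumn` are the cosets of the stabilizer `1 ⊕ U(N)`. -/
lemma exists_mul_embedUnitary {N : ℕ} {U V : UnitaryN (N + 1)}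
    (h : firstColumn U = firstColumn V) : ∃ W : UnitaryN N, U = V * embedUnitary W := by
  obtain ⟨W, hW⟩ := exists_embedUnitary_of_firstColumn (V⁻¹ * U) (by
    rw [firstColumn_mul, h, ← firstColumn_mul, inv_mul_cancel]
    simp [firstColumn])
  exact ⟨W, by rw [hW]; simp⟩

/-! ### Peeling off the last layer -/

/-- Parameters `(γ, θ, φ)` of a single layer with `N` interferometers. -/
abbrev LayerParams (N : ℕ) : Type := ℝ × (Fin N → ℝ) × (Fin N → ℝ)

/-- The product of the interferometers of a layer acting on all `N + 1` modes. -/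
def layerBlock {N : ℕ} (θ φ : Fin N → ℝ) : Matrix (Fin (N + 1)) (Fin (N + 1)) ℂ :=
  (List.ofFn fun k : Fin N =>
    givens k.succ.rev k.castSucc.rev (mziBlock (θ k) (φ k))).prod

/-- The operator of a layer acting on all `N + 1` modes. -/
def fullLayer {N : ℕ} (l : LayerParams N) : Matrix (Fin (N + 1)) (Fin (N + 1)) ℂ :=
  layerBlock l.2.1 l.2.2 * modePhase 0 l.1

lemma layerBlock_mem {N : ℕ} (θ φ : Fin N → ℝ) :
    layerBlock θ φ ∈ Matrix.unitaryGroup (Fin (N + 1)) ℂ := by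
  refine list_prod_mem ?_
  intro x hx
  obtain ⟨k, rfl⟩ := (List.mem_ofFn' _ _).mp hx
  refine givens_mem ?_ (mziBlock_mem _ _)
  rw [Ne, Fin.rev_inj]
  exact (Fin.castSucc_lt_succ).ne'

/-- The unitary operator of a layer acting on all `N + 1` modes. -/
def layerUnitary {N : ℕ} (l : LayerParams N) : UnitaryN (N + 1) :=
  ⟨fullLayer l, mul_mem (layerBlock_mem _ _) (modePhase_mem _ _)⟩

/-- The parameters of the last layer of a mesh. -/
def topLayer {N : ℕ} (q : Params (N + 1)) : LayerParams N :=
  (q.1 0, fun k => q.2.1 ⟨Fin.last N, k⟩, fun k => q.2.2 ⟨Fin.last N, k⟩)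

/-- The parameters of a mesh without its last layer. -/
def subMesh {N : ℕ} (q : Params (N + 1)) : Params N :=
  (fun i => q.1 i.succ, fun p => q.2.1 ⟨p.1.castSucc, p.2⟩, fun p => q.2.2 ⟨p.1.castSucc, p.2⟩)

lemma layerMatrix_last {N : ℕ} (q : Params (N + 1)) :
    layerMatrix q (Fin.last N) = fullLayer (topLayer q) := by
  rw [layerMatrix, fullLayer, layerBlock, Fin.rev_last]
  rfl

/-- Modes are counted by `Fin.rev`, so adding a mode creates a new index `0` and raises every old
mode index by one. -/
lemma layerMatrix_castSucc {N : ℕ} (q : Params (N + 1)) (m : Fin N) :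
    layerMatrix q m.castSucc = embedMatrix (layerMatrix (subMesh q) m) := by
  rw [layerMatrix, layerMatrix, embedMatrix_mul, Fin.rev_castSucc, modePhase_succ]
  congr 1
  change _ = embedMatrixHom N _
  rw [map_list_prod, List.map_ofFn]
  congr 2
  funext k
  change _ = embedMatrix _
  rw [← givens_succ_succ]
  congr 1
  · simp only [upperMode, Fin.ext_iff, Fin.val_rev, Fin.val_succ]
    have := k.2; have := m.2
    simp only [Fin.val_castSucc] at *
    omega
  · simp only [lowerMode, Fin.ext_iff, Fin.val_rev, Fin.val_succ]
    have := k.2; have := m.2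
    simp only [Fin.val_castSucc] at *
    omega

lemma meshMatrix_succ {N : ℕ} (q : Params (N + 1)) :
    meshMatrix q = fullLayer (topLayer q) * embedMatrix (meshMatrix (subMesh q)) := by
  rw [meshMatrix, List.ofFn_succ, List.prod_cons, Fin.rev_zero, layerMatrix_last]
  congr 1
  change _ = embedMatrixHom N _
  rw [meshMatrix, map_list_prod, List.map_ofFn]
  congr 2
  funext i
  rw [Fin.rev_succ, layerMatrix_castSucc]
  rfl

lemma mesh_succ {N : ℕ} (q : Params (N + 1)) :
    mesh q = layerUnitary (topLayer q) * embedUnitary (mesh (subMesh q)) :=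
  Subtype.ext (meshMatrix_succ q)

/-- Only the rightmost interferometer, which couples modes `0` and `1`, touches mode `0`; the others
form a layer one size smaller. -/
lemma layerBlock_succ {N : ℕ} (θ φ : Fin (N + 1) → ℝ) :
    layerBlock θ φ
      = embedMatrix (layerBlock (fun k => θ k.castSucc) fun k => φ k.castSucc)
        * givens 0 1 (mziBlock (θ (Fin.last N)) (φ (Fin.last N))) := by
  rw [layerBlock, List.ofFn_succ', List.concat_eq_append, List.prod_append, List.prod_singleton]
  congr 1
  · change _ = embedMatrixHom _ _
    rw [layerBlock, map_list_prod, List.map_ofFn]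
    congr 2
    funext k
    change _ = embedMatrix _
    rw [← givens_succ_succ, ← Fin.rev_castSucc, ← Fin.rev_castSucc, Fin.succ_castSucc]
  · rw [Fin.succ_last, Fin.rev_last, Fin.rev_castSucc, Fin.rev_last]
    rfl

/-! ### Entries of an interferometer -/

/-- The first column of `B R_θ B` is `(e^{iθ} - 1) / 2`, `i (e^{iθ} + 1) / 2`; the half-angle forms
make both entries `i e^{iθ/2}` times a sine or a cosine. -/
lemma exp_half_sub (θ : ℝ) :
    Complex.exp (Complex.I * θ) - 1
      = 2 * Complex.I * Complex.exp (Complex.I * (θ / 2)) * Complex.sin (θ / 2) := by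
  have h : Complex.exp (Complex.I * θ)
      = Complex.exp (Complex.I * (θ / 2)) * Complex.exp (Complex.I * (θ / 2)) := by
    rw [← Complex.exp_add]; ring_nf
  have h' : Complex.exp (Complex.I * (θ / 2)) * Complex.exp (-(θ / 2) * Complex.I) = 1 := by
    rw [← Complex.exp_add]; ring_nf; simp
  rw [Complex.sin, h, mul_comm ((θ : ℂ) / 2) Complex.I]
  linear_combination -(Complex.exp (Complex.I * (θ / 2)) * Complex.exp (-(θ / 2) * Complex.I) -
    Complex.exp (Complex.I * (θ / 2)) * Complex.exp (Complex.I * (θ / 2))) * Complex.I_sq + h'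

lemma exp_half_add (θ : ℝ) :
    Complex.exp (Complex.I * θ) + 1
      = 2 * Complex.exp (Complex.I * (θ / 2)) * Complex.cos (θ / 2) := by
  have h : Complex.exp (Complex.I * θ)
      = Complex.exp (Complex.I * (θ / 2)) * Complex.exp (Complex.I * (θ / 2)) := by
    rw [← Complex.exp_add]; ring_nf
  have h' : Complex.exp (Complex.I * (θ / 2)) * Complex.exp (-(θ / 2) * Complex.I) = 1 := by
    rw [← Complex.exp_add]; ring_nf; simp
  rw [Complex.cos, h, mul_comm ((θ : ℂ) / 2) Complex.I]
  linear_combination -h'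

lemma inv_sqrt_two_mul_self : ((Real.sqrt 2 : ℝ) : ℂ)⁻¹ * ((Real.sqrt 2 : ℝ) : ℂ)⁻¹ = 1 / 2 := by
  rw [← mul_inv, ← Complex.ofReal_mul, Real.mul_self_sqrt (by norm_num)]
  norm_num

/-- The internal phase `i e^{iθ/2}` common to the entries of an interferometer. -/
def internalPhase (θ : ℝ) : ℂ := Complex.I * Complex.exp (Complex.I * (θ / 2))

lemma norm_exp_I_mul (x : ℝ) : ‖Complex.exp (Complex.I * x)‖ = 1 := by
  rw [mul_comm, Complex.norm_exp_ofReal_mul_I]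

lemma norm_internalPhase (θ : ℝ) : ‖internalPhase θ‖ = 1 := by
  have := norm_exp_I_mul (θ / 2)
  push_cast at this
  simp [internalPhase, this]

lemma mziBlock_zero_zero (θ φ : ℝ) :
    mziBlock θ φ 0 0
      = Complex.exp (Complex.I * φ) * internalPhase θ * (Real.sin (θ / 2) : ℝ) := by
  have h := exp_half_sub θ
  have h2 := inv_sqrt_two_mul_self
  simp only [mziBlock, upperPhase, beamsplitter, internalPhase, Matrix.mul_apply, Fin.sum_univ_two,
    Matrix.smul_apply, smul_eq_mul]
  simp
  linear_combination Complex.exp (Complex.I * φ) * (((Real.sqrt 2 : ℝ) : ℂ)⁻¹ ^ 2 * Complex.I_sq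
    + (Complex.exp (Complex.I * θ) - 1) * h2 + h / 2)

lemma mziBlock_one_zero (θ φ : ℝ) :
    mziBlock θ φ 1 0 = internalPhase θ * (Real.cos (θ / 2) : ℝ) := by
  have h := exp_half_add θ
  have h2 := inv_sqrt_two_mul_self
  simp only [mziBlock, upperPhase, beamsplitter, internalPhase, Matrix.mul_apply, Fin.sum_univ_two,
    Matrix.smul_apply, smul_eq_mul]
  simp
  linear_combination Complex.I * ((Complex.exp (Complex.I * θ) + 1) * h2 + h / 2)

/-! ### The first column of a layer -/

/-- The first column of the product of the interferometers of a layer. -/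
def blockColumn {N : ℕ} (θ φ : Fin N → ℝ) : Fin (N + 1) → ℂ :=
  Matrix.mulVec (layerBlock θ φ) (Fin.cons 1 0)

lemma blockColumn_zero (θ φ : Fin 0 → ℝ) : blockColumn θ φ = fun _ => 1 := by
  funext i
  rw [show i = 0 from Fin.fin_one_eq_zero i]
  simp [blockColumn, layerBlock]

/-- The rightmost interferometer acts first and spreads the first basis vector over modes `0` and
`1`. The rest of the layer sees only the amplitude in mode `1`, which is the first mode of the
shorter layer. -/
lemma blockColumn_succ {N : ℕ} (θ φ : Fin (N + 1) → ℝ) :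
    blockColumn θ φ = Fin.cons
      (Complex.exp (Complex.I * φ (Fin.last N)) * internalPhase (θ (Fin.last N))
        * (Real.sin (θ (Fin.last N) / 2) : ℝ))
      ((internalPhase (θ (Fin.last N)) * (Real.cos (θ (Fin.last N) / 2) : ℝ)) •
        blockColumn (fun k => θ k.castSucc) fun k => φ k.castSucc) := by
  have hg : ∀ A : Matrix (Fin 2) (Fin 2) ℂ,
      Matrix.mulVec (givens (0 : Fin (N + 2)) 1 A) (Fin.cons 1 0)
        = Fin.cons (A 0 0) (A 1 0 • (Fin.cons 1 0 : Fin (N + 1) → ℂ)) := by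
    intro A
    ext i
    refine Fin.cases ?_ (fun i => ?_) i
    · simp [Matrix.mulVec, dotProduct, Fin.sum_univ_succ, givens]
    · refine Fin.cases ?_ (fun i => ?_) i
      · simp [Matrix.mulVec, dotProduct, Fin.sum_univ_succ, givens]
      · have h0 : i.succ.succ ≠ 0 := Fin.succ_ne_zero _
        have h1 : i.succ.succ ≠ 1 := by
          rw [← Fin.succ_zero_eq_one, Ne, Fin.succ_inj]
          exact Fin.succ_ne_zero _
        simp [Matrix.mulVec, dotProduct, givens, h1]
  rw [blockColumn, layerBlock_succ, ← Matrix.mulVec_mulVec, hg, embedMatrix_mulVec,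
    Matrix.mulVec_smul, mziBlock_zero_zero, mziBlock_one_zero]
  rfl

/-- The first column of a layer. -/
def layerColumn {N : ℕ} (l : LayerParams N) : Fin (N + 1) → ℂ :=
  Complex.exp (Complex.I * l.1) • blockColumn l.2.1 l.2.2

lemma firstColumn_layerUnitary {N : ℕ} (l : LayerParams N) :
    firstColumn (layerUnitary l) = layerColumn l := by
  have h : Matrix.mulVec (modePhase (0 : Fin (N + 1)) l.1) (Fin.cons 1 0)
      = Complex.exp (Complex.I * l.1) • (Fin.cons 1 0 : Fin (N + 1) → ℂ) := by
    ext i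
    refine Fin.cases ?_ (fun i => ?_) i <;> simp [modePhase, Matrix.mulVec_diagonal]
  rw [firstColumn, layerColumn, blockColumn]
  change Matrix.mulVec (layerBlock _ _ * modePhase _ _) _ = _
  rw [← Matrix.mulVec_mulVec, h, Matrix.mulVec_smul]

lemma sum_normSq_layerColumn {N : ℕ} (l : LayerParams N) :
    ∑ i, Complex.normSq (layerColumn l i) = 1 := by
  rw [← firstColumn_layerUnitary, sum_normSq_firstColumn]

/-! ### Continuity of the parametrization -/

lemma continuous_internalPhase : Continuous internalPhase := by
  unfold internalPhase
  fun_prop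

lemma continuous_mziBlock {X : Type*} [TopologicalSpace X] {f g : X → ℝ} (hf : Continuous f)
    (hg : Continuous g) : Continuous fun x => mziBlock (f x) (g x) := by
  have h : Continuous upperPhase := by
    refine continuous_matrix fun i j => ?_
    fin_cases i <;> fin_cases j <;> simp [upperPhase] <;> fun_prop
  unfold mziBlock
  exact (((h.comp hg).mul continuous_const).mul (h.comp hf)).mul
    continuous_const

lemma continuous_givens {N : ℕ} (a b : Fin N) : Continuous (givens a b) := by
  refine continuous_matrix fun i j => ?_
  simp only [givens, Matrix.of_apply]
  split_ifs
  all_goals first | exact continuous_id.matrix_elem _ _ | exact continuous_const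

lemma continuous_list_prod_ofFn {X M : Type*} [TopologicalSpace X] [TopologicalSpace M] [Monoid M]
    [ContinuousMul M] {n : ℕ} {f : Fin n → X → M} (hf : ∀ i, Continuous (f i)) :
    Continuous fun x => (List.ofFn fun i => f i x).prod := by
  induction n with
  | zero => simpa using continuous_const
  | succ n ih =>
    simp only [List.ofFn_succ, List.prod_cons]
    exact (hf 0).mul (ih fun i => hf i.succ)

lemma continuous_layerUnitary {N : ℕ} : Continuous (layerUnitary (N := N)) := by
  refine Continuous.subtype_mk ?_ _
  unfold fullLayer layerBlock
  refine Continuous.mul (continuous_list_prod_ofFn (f := fun (k : Fin N) (l : LayerParams N) =>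
    givens k.succ.rev k.castSucc.rev (mziBlock (l.2.1 k) (l.2.2 k))) fun k => ?_) ?_
  · have h1 : Continuous fun l : LayerParams N => l.2.1 k := by fun_prop
    have h2 : Continuous fun l : LayerParams N => l.2.2 k := by fun_prop
    have h3 := continuous_mziBlock h1 h2
    exact (continuous_givens k.succ.rev k.castSucc.rev).comp h3
  · refine continuous_matrix fun i j => ?_
    simp only [modePhase, Matrix.diagonal_apply]
    split_ifs <;> fun_prop

lemma continuous_layerColumn {N : ℕ} : Continuous (layerColumn (N := N)) := by
  have := continuous_firstColumn.comp (continuous_layerUnitary (N := N))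
  simpa [Function.comp_def, firstColumn_layerUnitary] using this

lemma continuous_topLayer {N : ℕ} : Continuous (topLayer (N := N)) := by
  unfold topLayer
  fun_prop

lemma continuous_subMesh {N : ℕ} : Continuous (subMesh (N := N)) := by
  unfold subMesh
  fun_prop

lemma continuous_mesh {N : ℕ} : Continuous (mesh (N := N)) := by
  induction N with
  | zero => exact continuous_of_const fun _ _ => Subtype.ext (Subsingleton.elim _ _)
  | succ N ih =>
    rw [show mesh (N := N + 1) = fun q => layerUnitary (topLayer q)
      * embedUnitary (mesh (subMesh q)) from funext mesh_succ]
    exact (continuous_layerUnitary.comp continuous_topLayer).mul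
      (continuous_embedUnitary.comp (ih.comp continuous_subMesh))

/-! ### Phases -/

lemma exists_phase {u : ℂ} (hu : ‖u‖ = 1) :
    ∃ γ ∈ Set.Ico 0 (2 * Real.pi), Complex.exp (Complex.I * (γ : ℝ)) = u := by
  refine ⟨toIcoMod Real.two_pi_pos 0 u.arg, ?_, ?_⟩
  · simpa using toIcoMod_mem_Ico Real.two_pi_pos 0 u.arg
  · have h := Complex.norm_mul_exp_arg_mul_I u
    rw [hu] at h
    rw [toIcoMod]
    have : Complex.I * ((u.arg - toIcoDiv Real.two_pi_pos 0 u.arg • (2 * Real.pi) : ℝ) : ℂ)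
        = u.arg * Complex.I
          - (toIcoDiv Real.two_pi_pos 0 u.arg : ℤ) * (2 * Real.pi * Complex.I) := by
      push_cast [zsmul_eq_mul]
      ring
    rw [this, Complex.exp_sub, Complex.exp_int_mul_two_pi_mul_I, div_one]
    simpa using h

lemma phase_injOn : Set.InjOn (fun γ : ℝ => Complex.exp (Complex.I * γ))
    (Set.Ico 0 (2 * Real.pi)) := by
  intro x hx y hy h
  obtain ⟨n, hn⟩ := Complex.exp_eq_exp_iff_exists_int.mp h
  have h1 : (x : ℂ) = y + n * (2 * Real.pi) := by
    apply mul_left_cancel₀ Complex.I_ne_zero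
    rw [hn]; ring
  have h2 : x = y + n * (2 * Real.pi) := by exact_mod_cast h1
  have hpi := Real.two_pi_pos
  have h3 : (n : ℝ) < 1 := by
    by_contra hc
    have : (1 : ℝ) * (2 * Real.pi) ≤ n * (2 * Real.pi) := by gcongr; linarith
    linarith [hx.2, hy.1]
  have h4 : (-1 : ℝ) < n := by
    by_contra hc
    have : (n : ℝ) * (2 * Real.pi) ≤ (-1) * (2 * Real.pi) := by gcongr; linarith
    linarith [hx.1, hy.2]
  have h5 : n = 0 := by
    have h3' : n < 1 := by exact_mod_cast h3
    have h4' : -1 < n := by exact_mod_cast h4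
    omega
  simpa [h5] using h2

/-! ### Coordinates of the first column of a layer -/

/-- The parameter domain of a layer. -/
def layerDomain (N : ℕ) : Set (LayerParams N) :=
  {l | l.1 ∈ Set.Ico 0 (2 * Real.pi) ∧ (∀ k, l.2.1 k ∈ Set.Icc 0 Real.pi) ∧
    ∀ k, l.2.2 k ∈ Set.Ico 0 (2 * Real.pi)}

/-- The parameters of a layer whose interferometers are neither in the bar nor in the
cross state. -/
def layerInterior (N : ℕ) : Set (LayerParams N) :=
  {l | l.1 ∈ Set.Ico 0 (2 * Real.pi) ∧ (∀ k, l.2.1 k ∈ Set.Ioo 0 Real.pi) ∧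
    ∀ k, l.2.2 k ∈ Set.Ico 0 (2 * Real.pi)}

lemma layerInterior_subset (N : ℕ) : layerInterior N ⊆ layerDomain N :=
  fun _ h => ⟨h.1, fun k => Set.Ioo_subset_Icc_self (h.2.1 k), h.2.2⟩

/-- The parameters of a layer without its last interferometer. -/
def initLayer {N : ℕ} (l : LayerParams (N + 1)) : LayerParams N :=
  (l.1, fun k => l.2.1 k.castSucc, fun k => l.2.2 k.castSucc)

/-- The phase `γ` is absorbed into the shorter layer on the tail. In the first entry it is grouped
with the internal phase into one unit factor, so that `φ` can be solved for last. -/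
lemma layerColumn_succ {N : ℕ} (l : LayerParams (N + 1)) :
    layerColumn l = Fin.cons
      (Complex.exp (Complex.I * l.2.2 (Fin.last N))
        * (Complex.exp (Complex.I * l.1) * internalPhase (l.2.1 (Fin.last N)))
        * (Real.sin (l.2.1 (Fin.last N) / 2) : ℝ))
      ((internalPhase (l.2.1 (Fin.last N)) * (Real.cos (l.2.1 (Fin.last N) / 2) : ℝ)) •
        layerColumn (initLayer l)) := by
  rw [layerColumn, blockColumn_succ]
  ext i
  refine Fin.cases ?_ (fun i => ?_) i
  · simp only [Pi.smul_apply, Fin.cons_zero, smul_eq_mul]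
    ring
  · simp only [Pi.smul_apply, Fin.cons_succ, smul_eq_mul, layerColumn, initLayer]
    ring

lemma layerColumn_zero (l : LayerParams 0) :
    layerColumn l = fun _ => Complex.exp (Complex.I * l.1) := by
  rw [layerColumn, blockColumn_zero]
  ext i
  simp

lemma internalPhase_ne_zero (θ : ℝ) : internalPhase θ ≠ 0 := by
  rw [← norm_ne_zero_iff, norm_internalPhase]
  exact one_ne_zero

/-- Every unit vector is the first column of a layer. -/
lemma exists_layerColumn_eq {N : ℕ} (z : Fin (N + 1) → ℂ)
    (hz : ∑ i, Complex.normSq (z i) = 1) : ∃ l ∈ layerDomain N, layerColumn l = z := by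
  induction N with
  | zero =>
    have h1 : ‖z 0‖ = 1 := by
      have : Complex.normSq (z 0) = 1 := by simpa using hz
      rw [Complex.norm_def, this, Real.sqrt_one]
    obtain ⟨γ, hγ, h⟩ := exists_phase h1
    refine ⟨(γ, Fin.elim0, Fin.elim0), ⟨hγ, fun k => k.elim0, fun k => k.elim0⟩, ?_⟩
    rw [layerColumn_zero]
    funext i
    rw [show i = 0 from Fin.fin_one_eq_zero i, ← h]
  | succ N ih =>
    rw [Fin.sum_univ_succ] at hz
    set a : ℝ := ‖z 0‖ with ha
    have ha0 : 0 ≤ a := norm_nonneg _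
    have hsum : 0 ≤ ∑ i : Fin (N + 1), Complex.normSq (z i.succ) :=
      Finset.sum_nonneg fun _ _ => Complex.normSq_nonneg _
    rw [Complex.normSq_eq_norm_sq, ← ha] at hz
    have ha1 : a ≤ 1 := by nlinarith
    -- This angle is forced by `|z 0| = sin (θ / 2)`.
    set θ : ℝ := 2 * Real.arcsin a with hθ
    have hθ2 : θ / 2 = Real.arcsin a := by rw [hθ]; ring
    have hsin : Real.sin (θ / 2) = a := by
      rw [hθ2, Real.sin_arcsin (by linarith) ha1]
    have hcos2 : Real.cos (θ / 2) ^ 2 = ∑ i : Fin (N + 1), Complex.normSq (z i.succ) := by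
      rw [Real.cos_sq', hsin]; linarith
    have hθmem : θ ∈ Set.Icc 0 Real.pi := by
      constructor
      · have := Real.arcsin_nonneg.mpr ha0; linarith
      · have := Real.arcsin_le_pi_div_two a; linarith
    have hp := internalPhase_ne_zero θ
    obtain ⟨w, hw1, hw⟩ : ∃ w : Fin (N + 1) → ℂ, ∑ i, Complex.normSq (w i) = 1 ∧
        (internalPhase θ * (Real.cos (θ / 2) : ℝ)) • w = fun i => z i.succ := by
      by_cases hc : Real.cos (θ / 2) = 0
      -- Here the tail of `z` vanishes, so any unit vector serves as `w`.
      · refine ⟨Fin.cons 1 0, by simp [Fin.sum_univ_succ], ?_⟩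
        rw [hc] at hcos2
        have h0 := (Finset.sum_eq_zero_iff_of_nonneg
          (fun i _ => Complex.normSq_nonneg (z (Fin.succ i)))).mp
            (show ∑ i : Fin (N + 1), Complex.normSq (z i.succ) = 0 by rw [← hcos2]; simp)
        funext i
        have := Complex.normSq_eq_zero.mp (h0 i (Finset.mem_univ _))
        rw [this, hc]
        simp
      · have hne : internalPhase θ * (Real.cos (θ / 2) : ℝ) ≠ 0 :=
          mul_ne_zero hp (Complex.ofReal_ne_zero.mpr hc)
        refine ⟨(internalPhase θ * (Real.cos (θ / 2) : ℝ))⁻¹ • fun i => z i.succ, ?_, ?_⟩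
        · simp only [Pi.smul_apply, smul_eq_mul, map_mul, map_inv₀, ← Finset.mul_sum]
          rw [← hcos2, Complex.normSq_eq_norm_sq (internalPhase θ), norm_internalPhase,
            Complex.normSq_ofReal]
          field_simp
        · rw [smul_smul, mul_inv_cancel₀ hne, one_smul]
    obtain ⟨l, hl, hlw⟩ := ih w hw1
    set u : ℂ := Complex.exp (Complex.I * l.1) * internalPhase θ with hu
    have hu1 : ‖u‖ = 1 := by rw [hu, norm_mul, norm_exp_I_mul, norm_internalPhase, one_mul]
    have hu0 : u ≠ 0 := by rw [← norm_ne_zero_iff, hu1]; exact one_ne_zero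
    obtain ⟨φ, hφ, hφz⟩ : ∃ φ ∈ Set.Ico 0 (2 * Real.pi),
        Complex.exp (Complex.I * (φ : ℝ)) * u * (a : ℂ) = z 0 := by
      -- If the first entry vanishes then `φ` has no effect and is set to `0`; otherwise it is the
      -- phase of `z 0` relative to `u`.
      by_cases h0 : z 0 = 0
      · refine ⟨0, ⟨le_rfl, Real.two_pi_pos⟩, ?_⟩
        rw [ha, h0]; simp
      · have ha' : a ≠ 0 := norm_ne_zero_iff.mpr h0
        obtain ⟨φ, hφ, h⟩ := exists_phase (u := z 0 / (u * (a : ℂ))) (by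
          rw [norm_div, norm_mul, hu1, Complex.norm_real, Real.norm_of_nonneg ha0, one_mul, ← ha,
            div_self ha'])
        refine ⟨φ, hφ, ?_⟩
        have : (a : ℂ) ≠ 0 := Complex.ofReal_ne_zero.mpr ha'
        rw [h]
        field_simp
    refine ⟨(l.1, Fin.snoc l.2.1 θ, Fin.snoc l.2.2 φ), ⟨hl.1, fun k => ?_, fun k => ?_⟩, ?_⟩
    · refine Fin.lastCases ?_ (fun k => ?_) k
      · simpa using hθmem
      · simpa using hl.2.1 k
    · refine Fin.lastCases ?_ (fun k => ?_) k
      · simpa using hφ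
      · simpa using hl.2.2 k
    · rw [layerColumn_succ]
      have hinit : initLayer (N := N) (l.1, Fin.snoc l.2.1 θ, Fin.snoc l.2.2 φ) = l := by
        simp [initLayer]
      rw [hinit, hlw]
      simp only [Fin.snoc_last]
      rw [hw, hsin, ← hu, hφz]
      exact Fin.cons_self_tail z

/-- In the interior, a layer is determined by its first column. -/
lemma layerColumn_inj {N : ℕ} {l l' : LayerParams N} (hl : l ∈ layerInterior N)
    (hl' : l' ∈ layerDomain N) (h : layerColumn l = layerColumn l') : l = l' := by
  induction N with
  | zero =>
    have h0 := congrFun h 0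
    rw [layerColumn_zero, layerColumn_zero] at h0
    exact Prod.ext (phase_injOn hl.1 hl'.1 h0) (Subsingleton.elim _ _)
  | succ N ih =>
    rw [layerColumn_succ, layerColumn_succ] at h
    obtain ⟨h0, hs⟩ := Fin.cons_inj.mp h
    have hθ1 := hl.2.1 (Fin.last N)
    have hθ1' := hl'.2.1 (Fin.last N)
    have hsin0 : 0 < Real.sin (l.2.1 (Fin.last N) / 2) :=
      Real.sin_pos_of_pos_of_lt_pi (by linarith [hθ1.1]) (by linarith [hθ1.1, hθ1.2])
    have hsin0' : 0 ≤ Real.sin (l'.2.1 (Fin.last N) / 2) :=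
      Real.sin_nonneg_of_nonneg_of_le_pi (by linarith [hθ1'.1])
        (by linarith [hθ1'.1, hθ1'.2])
    -- The moduli of the first entries determine `θ`, since the sine is injective on `[0, π / 2]`.
    -- Then `cos (θ / 2) ≠ 0` lets the tails be compared, and `sin (θ / 2) ≠ 0` recovers `φ`.
    have hsin : Real.sin (l.2.1 (Fin.last N) / 2) = Real.sin (l'.2.1 (Fin.last N) / 2) := by
      have := congrArg norm h0
      simpa only [norm_mul, norm_exp_I_mul, norm_internalPhase, one_mul, Complex.norm_real,
        Real.norm_of_nonneg hsin0.le, Real.norm_of_nonneg hsin0'] using this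
    have hθ : l.2.1 (Fin.last N) = l'.2.1 (Fin.last N) := by
      have := Real.injOn_sin
        ⟨by linarith [hθ1.1, Real.pi_pos], by linarith [hθ1.2]⟩
        ⟨by linarith [hθ1'.1, Real.pi_pos], by linarith [hθ1'.2]⟩ hsin
      linarith
    have hcos0 : 0 < Real.cos (l.2.1 (Fin.last N) / 2) :=
      Real.cos_pos_of_mem_Ioo ⟨by linarith [hθ1.1, Real.pi_pos], by linarith [hθ1.2]⟩
    rw [← hθ] at h0 hs
    have hp := internalPhase_ne_zero (l.2.1 (Fin.last N))
    have hinit : initLayer l = initLayer l' := by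
      refine ih ⟨hl.1, fun k => hl.2.1 _, fun k => hl.2.2 _⟩
        ⟨hl'.1, fun k => hl'.2.1 _, fun k => hl'.2.2 _⟩ ?_
      exact smul_right_injective _
        (mul_ne_zero hp (Complex.ofReal_ne_zero.mpr hcos0.ne')) hs
    have hγ : l.1 = l'.1 := congrArg (fun l : LayerParams N => l.1) hinit
    have hφ : l.2.2 (Fin.last N) = l'.2.2 (Fin.last N) := by
      refine phase_injOn (hl.2.2 _) (hl'.2.2 _) ?_
      have h1 := mul_right_cancel₀ (Complex.ofReal_ne_zero.mpr hsin0.ne') h0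
      rw [← hγ] at h1
      exact mul_right_cancel₀ (mul_ne_zero (Complex.exp_ne_zero _) hp) h1
    refine Prod.ext hγ (Prod.ext (funext fun k => ?_) (funext fun k => ?_))
    · refine Fin.lastCases hθ (fun k => ?_) k
      exact congrFun (congrArg (fun l => l.2.1) hinit) k
    · refine Fin.lastCases hφ (fun k => ?_) k
      exact congrFun (congrArg (fun l => l.2.2) hinit) k

/-! ### Coordinates of the mesh -/

/-- The interferometers of a mesh are those of its last layer and those of the smaller mesh. -/
def mziEquiv (N : ℕ) : Fin N ⊕ MZI N ≃ MZI (N + 1) :=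
  Equiv.ofBijective
    (Sum.elim (fun k => ⟨Fin.last N, k⟩) fun p => ⟨p.1.castSucc, p.2⟩) <| by
    constructor
    · rintro (k | ⟨m, k⟩) (k' | ⟨m', k'⟩) h
      · simpa using h
      · simp only [Sum.elim_inl, Sum.elim_inr, Sigma.mk.injEq] at h
        exact absurd h.1 (Fin.castSucc_lt_last m').ne'
      · simp only [Sum.elim_inl, Sum.elim_inr, Sigma.mk.injEq] at h
        exact absurd h.1 (Fin.castSucc_lt_last m).ne
      · simp only [Sum.elim_inr, Sigma.mk.injEq, Fin.castSucc_inj] at h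
        obtain ⟨rfl, h⟩ := h
        rw [eq_of_heq h]
    · rintro ⟨m, k⟩
      induction m using Fin.lastCases with
      | last => exact ⟨Sum.inl k, rfl⟩
      | cast m => exact ⟨Sum.inr ⟨m, k⟩, rfl⟩

lemma forall_mzi_succ {N : ℕ} {P : MZI (N + 1) → Prop} :
    (∀ p, P p) ↔ (∀ k : Fin N, P ⟨Fin.last N, k⟩) ∧ ∀ p : MZI N, P ⟨p.1.castSucc, p.2⟩ := by
  rw [← (mziEquiv N).forall_congr_right, Sum.forall]
  rfl

lemma params_ext {N : ℕ} {q q' : Params (N + 1)} (h : topLayer q = topLayer q')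
    (h' : subMesh q = subMesh q') : q = q' := by
  simp only [topLayer, subMesh, Prod.mk.injEq] at h h'
  refine Prod.ext (funext ?_) (Prod.ext (funext ?_) (funext ?_))
  · exact Fin.cases h.1 fun i => congrFun h'.1 i
  · exact forall_mzi_succ.mpr ⟨congrFun h.2.1, congrFun h'.2.1⟩
  · exact forall_mzi_succ.mpr ⟨congrFun h.2.2, congrFun h'.2.2⟩

lemma exists_params {N : ℕ} (l : LayerParams N) (q : Params N) :
    ∃ r : Params (N + 1), topLayer r = l ∧ subMesh r = q := by
  have hl : ∀ k, (mziEquiv N).symm ⟨Fin.last N, k⟩ = Sum.inl k := fun k =>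
    (mziEquiv N).symm_apply_apply (Sum.inl k)
  have hr : ∀ p : MZI N, (mziEquiv N).symm ⟨p.1.castSucc, p.2⟩ = Sum.inr p := fun p =>
    (mziEquiv N).symm_apply_apply (Sum.inr p)
  exact ⟨(Fin.cons l.1 q.1, fun p => Sum.elim l.2.1 q.2.1 ((mziEquiv N).symm p),
    fun p => Sum.elim l.2.2 q.2.2 ((mziEquiv N).symm p)),
    by simp [topLayer, hl], by simp [subMesh, hr]⟩

lemma mem_paramDomain_succ {N : ℕ} {q : Params (N + 1)} :
    q ∈ paramDomain (N + 1) ↔ topLayer q ∈ layerDomain N ∧ subMesh q ∈ paramDomain N := by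
  simp only [paramDomain, layerDomain, Set.mem_ofPred_eq, forall_mzi_succ, Fin.forall_fin_succ,
    topLayer, subMesh]
  tauto

/-- The parameters of a mesh whose interferometers are neither in the bar nor in the cross
state. -/
def paramInterior (N : ℕ) : Set (Params N) :=
  {q | (∀ n, q.1 n ∈ Set.Ico 0 (2 * Real.pi)) ∧ (∀ p, q.2.1 p ∈ Set.Ioo 0 Real.pi) ∧
    ∀ p, q.2.2 p ∈ Set.Ico 0 (2 * Real.pi)}

lemma paramInterior_subset (N : ℕ) : paramInterior N ⊆ paramDomain N :=
  fun _ h => ⟨h.1, fun k => Set.Ioo_subset_Icc_self (h.2.1 k), h.2.2⟩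

lemma mem_paramInterior_succ {N : ℕ} {q : Params (N + 1)} :
    q ∈ paramInterior (N + 1) ↔ topLayer q ∈ layerInterior N ∧ subMesh q ∈ paramInterior N := by
  simp only [paramInterior, layerInterior, Set.mem_ofPred_eq, forall_mzi_succ, Fin.forall_fin_succ,
    topLayer, subMesh]
  tauto

instance instSubsingletonUnitaryZero : Subsingleton (UnitaryN 0) :=
  ⟨fun _ _ => Subtype.ext (Subsingleton.elim _ _)⟩

/-- Every unitary matrix is realized by the mesh. -/
lemma exists_mesh_eq {N : ℕ} (U : UnitaryN N) : ∃ q ∈ paramDomain N, mesh q = U := by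
  induction N with
  | zero => exact ⟨(Fin.elim0, fun p => p.1.elim0, fun p => p.1.elim0),
      ⟨fun n => n.elim0, fun p => p.1.elim0, fun p => p.1.elim0⟩, Subsingleton.elim _ _⟩
  | succ N ih =>
    -- Once a layer matches the first column, what remains of `U` is `1 ⊕ W`, to which the induction
    -- hypothesis applies.
    obtain ⟨l, hl, hlU⟩ := exists_layerColumn_eq (firstColumn U) (sum_normSq_firstColumn U)
    rw [← firstColumn_layerUnitary] at hlU
    obtain ⟨W, hW⟩ := exists_mul_embedUnitary hlU.symm
    obtain ⟨q, hq, rfl⟩ := ih W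
    obtain ⟨r, rfl, rfl⟩ := exists_params l q
    exact ⟨r, mem_paramDomain_succ.mpr ⟨hl, hq⟩, by rw [mesh_succ, hW]⟩

/-- In the interior, the parameters are determined by the mesh operator. -/
lemma mesh_inj {N : ℕ} {q q' : Params N} (hq : q ∈ paramInterior N) (hq' : q' ∈ paramDomain N)
    (h : mesh q = mesh q') : q = q' := by
  induction N with
  | zero => exact Subsingleton.elim _ _
  | succ N ih =>
    rw [mem_paramInterior_succ] at hq
    rw [mem_paramDomain_succ] at hq'
    rw [mesh_succ, mesh_succ] at h
    have hcol := congrArg firstColumn h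
    rw [firstColumn_mul_embedUnitary, firstColumn_mul_embedUnitary, firstColumn_layerUnitary,
      firstColumn_layerUnitary] at hcol
    have hl := layerColumn_inj hq.1 hq'.1 hcol
    rw [hl] at h
    exact params_ext hl (ih hq.2 hq'.2 (embedUnitary_injective (mul_left_cancel h)))

/-! ### One-dimensional laws -/

lemma lintegral_restrict_withDensity {s : Set ℝ} {ρ g : ℝ → ENNReal} (hρ : Measurable ρ)
    (hg : Measurable g) :
    ∫⁻ x, g x ∂(volume.restrict s).withDensity ρ = ∫⁻ x in s, ρ x * g x :=
  lintegral_withDensity_eq_lintegral_mul _ hρ hg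

/-- Change of variables for laws given by a density on a subset of the line. -/
lemma map_withDensity_of_hasDerivWithinAt {s t : Set ℝ} (hs : MeasurableSet s) {f f' : ℝ → ℝ}
    (hf' : ∀ x ∈ s, HasDerivWithinAt f (f' x) s x) (hinj : Set.InjOn f s) (hf : Measurable f)
    (ht : f '' s = t) {ρ ρ' : ℝ → ENNReal} (hρ : Measurable ρ) (hρ' : Measurable ρ')
    (h : ∀ x ∈ s, ρ x = ENNReal.ofReal |f' x| * ρ' (f x)) :
    ((volume.restrict s).withDensity ρ).map f = (volume.restrict t).withDensity ρ' := by
  refine Measure.ext_of_lintegral _ fun g hg => ?_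
  rw [lintegral_map hg hf, lintegral_restrict_withDensity (g := fun x => g (f x)) hρ (hg.comp hf),
    lintegral_restrict_withDensity hρ' hg, ← ht,
    lintegral_image_eq_lintegral_abs_deriv_mul hs hf' hinj]
  refine setLIntegral_congr_fun hs fun x hx => ?_
  simp only [h x hx, mul_assoc]

lemma ae_mem_of_restrict_withDensity {s : Set ℝ} (hs : MeasurableSet s) (ρ : ℝ → ENNReal) :
    ∀ᵐ x ∂(volume.restrict s).withDensity ρ, x ∈ s :=
  (withDensity_absolutelyContinuous _ _).ae_le (ae_restrict_mem hs)

lemma measurable_transmissivity : Measurable transmissivity := by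
  unfold transmissivity; fun_prop

lemma measurable_densityT (α : ℕ) : Measurable (densityT α) := by
  unfold densityT; fun_prop

lemma measurable_densityTheta (α : ℕ) : Measurable (densityTheta α) := by
  unfold densityTheta; fun_prop

lemma transmissivity_mem {θ : ℝ} : transmissivity θ ∈ Set.Icc (0 : ℝ) 1 :=
  ⟨sq_nonneg _, Real.cos_sq_le_one _⟩

lemma cos_half_nonneg {θ : ℝ} (hθ : θ ∈ Set.Icc 0 Real.pi) : 0 ≤ Real.cos (θ / 2) :=
  Real.cos_nonneg_of_mem_Icc ⟨by linarith [hθ.1, Real.pi_pos], by linarith [hθ.2]⟩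

lemma sin_half_nonneg {θ : ℝ} (hθ : θ ∈ Set.Icc 0 Real.pi) : 0 ≤ Real.sin (θ / 2) :=
  Real.sin_nonneg_of_nonneg_of_le_pi (by linarith [hθ.1]) (by linarith [hθ.1, hθ.2])

lemma two_arccos_sqrt_transmissivity {θ : ℝ} (hθ : θ ∈ Set.Icc 0 Real.pi) :
    2 * Real.arccos (Real.sqrt (transmissivity θ)) = θ := by
  rw [transmissivity, Real.sqrt_sq (cos_half_nonneg hθ),
    Real.arccos_cos (by linarith [hθ.1]) (by linarith [hθ.1, hθ.2])]
  ring

lemma two_arccos_sqrt_mem (t : ℝ) :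
    2 * Real.arccos (Real.sqrt t) ∈ Set.Icc 0 Real.pi := by
  have h1 := Real.arccos_nonneg (Real.sqrt t)
  have h2 := Real.arccos_le_pi_div_two.mpr (Real.sqrt_nonneg t)
  constructor <;> linarith

lemma transmissivity_two_arccos_sqrt {t : ℝ} (ht : t ∈ Set.Icc (0 : ℝ) 1) :
    transmissivity (2 * Real.arccos (Real.sqrt t)) = t := by
  rw [transmissivity, mul_div_cancel_left₀ _ (two_ne_zero),
    Real.cos_arccos (by linarith [Real.sqrt_nonneg t]) (Real.sqrt_le_one.mpr ht.2),
    Real.sq_sqrt ht.1]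

lemma transmissivity_image : transmissivity '' Set.Icc 0 Real.pi = Set.Icc 0 1 := by
  apply Set.Subset.antisymm
  · rintro _ ⟨θ, -, rfl⟩
    exact transmissivity_mem
  · exact fun t ht => ⟨_, two_arccos_sqrt_mem t, transmissivity_two_arccos_sqrt ht⟩

lemma hasDerivAt_transmissivity (θ : ℝ) :
    HasDerivAt transmissivity (-(Real.sin (θ / 2) * Real.cos (θ / 2))) θ := by
  have h := (((hasDerivAt_id' θ).div_const 2).cos).pow 2
  refine h.congr_deriv ?_
  push_cast
  ring

/-- This is the Jacobian relation for `t = cos² (θ / 2)`, for which `|dt/dθ| = sin (θ / 2) cos (θ /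
2)`. Positivity of `α` keeps the subtractions in the exponents from truncating. -/
lemma densityTheta_eq {α : ℕ} (hα : 0 < α) (θ : ℝ) :
    densityTheta α θ
      = Real.sin (θ / 2) * Real.cos (θ / 2) * densityT α (transmissivity θ) := by
  obtain ⟨n, rfl⟩ : ∃ n, α = n + 1 := ⟨α - 1, by omega⟩
  have : 2 * (n + 1) - 1 = 2 * n + 1 := by omega
  rw [densityTheta, densityT, transmissivity, this, Nat.add_sub_cancel, ← pow_mul]
  ring

lemma map_transmissivity_lawTheta {α : ℕ} (hα : 0 < α) :
    (lawTheta α).map transmissivity = lawT α := by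
  refine map_withDensity_of_hasDerivWithinAt measurableSet_Icc
    (fun θ _ => (hasDerivAt_transmissivity θ).hasDerivWithinAt) ?_ measurable_transmissivity
    transmissivity_image (measurable_densityTheta α).ennreal_ofReal
    (measurable_densityT α).ennreal_ofReal ?_
  · intro x hx y hy h
    rw [← two_arccos_sqrt_transmissivity hx, h, two_arccos_sqrt_transmissivity hy]
  · intro θ hθ
    rw [← ENNReal.ofReal_mul (abs_nonneg _), abs_neg, abs_of_nonneg
      (mul_nonneg (sin_half_nonneg hθ) (cos_half_nonneg hθ)), densityTheta_eq hα]

lemma map_two_arccos_lawT {α : ℕ} (hα : 0 < α) :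
    (lawT α).map (fun t => 2 * Real.arccos (Real.sqrt t)) = lawTheta α := by
  rw [← map_transmissivity_lawTheta hα, Measure.map_map (by fun_prop) measurable_transmissivity]
  conv_rhs => rw [← Measure.map_id (μ := lawTheta α)]
  refine Measure.map_congr ?_
  filter_upwards [ae_mem_of_restrict_withDensity measurableSet_Icc _] with θ hθ
  exact two_arccos_sqrt_transmissivity hθ

lemma map_half_lawTheta (α : ℕ) : (lawTheta α).map (fun θ => θ / 2) = lawHalfTheta α := by
  refine map_withDensity_of_hasDerivWithinAt (f' := fun _ => 1 / 2) measurableSet_Icc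
    (fun θ _ => ((hasDerivAt_id' θ).div_const 2).hasDerivWithinAt)
    (fun x _ y _ h => by simpa using h) (by fun_prop) ?_
    (measurable_densityTheta α).ennreal_ofReal (by fun_prop) ?_
  · simp only [div_eq_mul_inv]
    rw [Set.image_mul_right_Icc Real.pi_pos.le (by norm_num)]
    simp
  · intro θ _
    rw [← ENNReal.ofReal_mul (abs_nonneg _), abs_of_pos (by norm_num), densityTheta]
    congr 1
    ring

/-- The derivative of `t ^ α` is exactly the density of `t`: a variable composed with its own
distribution function is uniform. -/
lemma map_pow_lawT {α : ℕ} (hα : 0 < α) : (lawT α).map (fun t => t ^ α) = uniformUnit := by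
  have hu : uniformUnit = (volume.restrict (Set.Icc (0 : ℝ) 1)).withDensity 1 := by
    simp [uniformUnit, ProbabilityTheory.cond, withDensity_one]
  rw [hu]
  refine map_withDensity_of_hasDerivWithinAt (f' := densityT α) measurableSet_Icc
    (fun t _ => (hasDerivAt_pow α t).hasDerivWithinAt)
    (fun x hx y hy h => (pow_left_inj₀ hx.1 hy.1 hα.ne').mp h) (by fun_prop) ?_
    (measurable_densityT α).ennreal_ofReal measurable_one ?_
  · apply Set.Subset.antisymm
    · rintro _ ⟨t, ht, rfl⟩
      exact ⟨pow_nonneg ht.1 _, pow_le_one₀ ht.1 ht.2⟩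
    · intro t ht
      refine ⟨t ^ ((α : ℝ)⁻¹), ⟨Real.rpow_nonneg ht.1 _,
        Real.rpow_le_one ht.1 ht.2 (by positivity)⟩, ?_⟩
      exact Real.rpow_inv_natCast_pow ht.1 hα.ne'
  · intro t ht
    have h0 : 0 ≤ densityT α t := mul_nonneg (Nat.cast_nonneg _) (pow_nonneg ht.1 _)
    rw [abs_of_nonneg h0, Pi.one_apply, mul_one]

lemma map_haarPhase_lawTheta {α : ℕ} (hα : 0 < α) :
    (lawTheta α).map (haarPhase α) = uniformUnit := by
  rw [← map_pow_lawT hα, ← map_transmissivity_lawTheta hα,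
    Measure.map_map (by fun_prop) measurable_transmissivity]
  rfl

instance instIsProbabilityMeasureUniformUnit : IsProbabilityMeasure uniformUnit :=
  ProbabilityTheory.cond_isProbabilityMeasure_of_finite (by simp) (by simp)

instance instIsProbabilityMeasureUniformPhase : IsProbabilityMeasure uniformPhase :=
  ProbabilityTheory.cond_isProbabilityMeasure_of_finite (by simp [Real.pi_pos])
    (by rw [Real.volume_Ico]; exact ENNReal.ofReal_ne_top)

/-- The total mass is read off from the image under the Haar phase, which is uniform. -/
lemma isProbabilityMeasure_lawTheta {α : ℕ} (hα : 0 < α) : IsProbabilityMeasure (lawTheta α) := by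
  have hm : Measurable (haarPhase α) := measurable_transmissivity.pow_const α
  have h := map_haarPhase_lawTheta hα
  refine ⟨?_⟩
  rw [← Set.preimage_univ (f := haarPhase α), ← Measure.map_apply hm MeasurableSet.univ, h,
    measure_univ]

lemma isProbabilityMeasure_lawT {α : ℕ} (hα : 0 < α) : IsProbabilityMeasure (lawT α) := by
  have := isProbabilityMeasure_lawTheta hα
  rw [← map_transmissivity_lawTheta hα]
  exact Measure.isProbabilityMeasure_map measurable_transmissivity.aemeasurable

/-! ### Uniform phases -/

/-- The freedom in the window `a` serves to absorb rotations and to match the angular range `(-π,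
π)` of polar coordinates. -/
lemma lintegral_uniformPhase {F : ℝ → ENNReal} (hF : Function.Periodic F (2 * Real.pi)) (a : ℝ) :
    ∫⁻ x, F x ∂uniformPhase
      = (ENNReal.ofReal (2 * Real.pi))⁻¹ * ∫⁻ x in Set.Ioc a (a + 2 * Real.pi), F x := by
  rw [uniformPhase, ProbabilityTheory.cond, lintegral_smul_measure, Real.volume_Ico, sub_zero,
    smul_eq_mul, setLIntegral_congr Ico_ae_eq_Ioc]
  congr 1
  have h := (isAddFundamentalDomain_Ioc Real.two_pi_pos 0).setLIntegral_eq
    (isAddFundamentalDomain_Ioc Real.two_pi_pos a) F ?_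
  · simpa using h
  · rintro ⟨_, n, rfl⟩ x
    rw [AddSubgroup.vadd_def, vadd_eq_add, add_comm]
    exact hF.zsmul n x

lemma periodic_exp_I_mul : Function.Periodic (fun x : ℝ => Complex.exp (Complex.I * x))
    (2 * Real.pi) := by
  intro x
  push_cast
  rw [mul_add, Complex.exp_add, mul_comm Complex.I (2 * (Real.pi : ℂ)), Complex.exp_two_pi_mul_I,
    mul_one]

/-- The law of a uniform phase factor is rotation invariant. -/
lemma lintegral_uniformPhase_mul (h : ℂ → ENNReal) {u : ℂ} (hu : ‖u‖ = 1) :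
    ∫⁻ x, h (Complex.exp (Complex.I * x) * u) ∂uniformPhase
      = ∫⁻ x, h (Complex.exp (Complex.I * x)) ∂uniformPhase := by
  obtain ⟨β, -, rfl⟩ := exists_phase hu
  have hshift : ∀ x : ℝ, Complex.exp (Complex.I * x) * Complex.exp (Complex.I * β)
      = Complex.exp (Complex.I * (x + β : ℝ)) := by
    intro x; rw [← Complex.exp_add]; push_cast; ring_nf
  simp only [hshift]
  have hper : Function.Periodic (fun x : ℝ => h (Complex.exp (Complex.I * x))) (2 * Real.pi) :=
    periodic_exp_I_mul.comp h
  -- Multiplication by `e^{iβ}` translates the angle by `β`, so a window starting at `0` on the left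
  -- matches one starting at `β` on the right.
  rw [lintegral_uniformPhase (F := fun x => h (Complex.exp (Complex.I * (x + β : ℝ))))
    (hper.add_const β) 0, lintegral_uniformPhase hper β]
  congr 1
  rw [← lintegral_indicator measurableSet_Ioc, ← lintegral_indicator measurableSet_Ioc,
    ← lintegral_add_right_eq_self (μ := volume) (Set.indicator (Set.Ioc β (β + 2 * Real.pi)) _) β]
  congr 1
  funext x
  simp only [Set.indicator, Set.mem_Ioc]
  congr 1
  apply propext
  constructor <;> rintro ⟨h1, h2⟩ <;> constructor <;> linarith

/-! ### Gamma laws -/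

/-- The Gamma law of shape `n + 1` and rate one. -/
def gammaLaw (n : ℕ) : Measure ℝ := ProbabilityTheory.gammaMeasure (n + 1) 1

instance instIsProbabilityMeasureGammaLaw (n : ℕ) : IsProbabilityMeasure (gammaLaw n) :=
  ProbabilityTheory.isProbabilityMeasure_gammaMeasure (by positivity) one_pos

/-- The density of the Gamma law of shape `n + 1`. -/
def gammaDensity (n : ℕ) (s : ℝ) : ℝ := s ^ n / n.factorial * Real.exp (-s)

lemma measurable_gammaDensity (n : ℕ) : Measurable (gammaDensity n) := by
  unfold gammaDensity; fun_prop

lemma gammaLaw_eq (n : ℕ) : gammaLaw n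
    = (volume.restrict (Set.Ioi 0)).withDensity fun s => ENNReal.ofReal (gammaDensity n s) := by
  rw [← withDensity_indicator measurableSet_Ioi, gammaLaw, ProbabilityTheory.gammaMeasure]
  refine withDensity_congr_ae ?_
  filter_upwards [compl_mem_ae_iff.mpr (measure_singleton (0 : ℝ))] with s hs
  have hs0 : s ≠ 0 := hs
  rcases lt_or_gt_of_ne hs0 with h | h
  · simp [ProbabilityTheory.gammaPDF, ProbabilityTheory.gammaPDFReal, Set.indicator, h.not_ge,
      h.le]
  · simp [ProbabilityTheory.gammaPDF, ProbabilityTheory.gammaPDFReal, Set.indicator, h, h.le,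
      gammaDensity, Real.Gamma_nat_eq_factorial]
    congr 1
    ring

lemma lintegral_gammaLaw (n : ℕ) {g : ℝ → ENNReal} (hg : Measurable g) :
    ∫⁻ s, g s ∂gammaLaw n = ∫⁻ s in Set.Ioi 0, ENNReal.ofReal (gammaDensity n s) * g s := by
  rw [gammaLaw_eq, lintegral_restrict_withDensity (measurable_gammaDensity n).ennreal_ofReal hg]

/-- Splitting a Gamma variable by an independent Beta variable. -/
lemma lintegral_gammaLaw_split (n : ℕ) {h : ℝ × ℝ → ENNReal} (hh : Measurable h) :
    ∫⁻ T, ∫⁻ t, h (T * t, T * (1 - t)) ∂lawT (n + 1) ∂gammaLaw (n + 1)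
      = ∫⁻ S, ∫⁻ s, h (S, s) ∂gammaLaw 0 ∂gammaLaw n := by
  -- With `T = S + s`, the joint density of independent Gamma variables of shapes `n + 1` and `1` is
  -- `S ^ n / n! * e^{-T}` on `0 < S < T`. Both sides of the claim are iterated integrals of `K`, in
  -- opposite orders.
  let K : ℝ → ℝ → ENNReal := fun S T =>
    (Set.Ioi (0 : ℝ)).indicator 1 S * ((Set.Ioi (0 : ℝ)).indicator 1 (T - S)
      * (ENNReal.ofReal (S ^ n / n.factorial * Real.exp (-T)) * h (S, T - S)))
  have hind : Measurable ((Set.Ioi (0 : ℝ)).indicator (1 : ℝ → ENNReal)) :=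
    measurable_one.indicator measurableSet_Ioi
  have hK : Measurable (Function.uncurry K) := by
    refine (hind.comp measurable_fst).mul ((hind.comp (measurable_snd.sub measurable_fst)).mul
      (Measurable.mul ?_ (hh.comp (measurable_fst.prodMk (measurable_snd.sub measurable_fst)))))
    fun_prop
  have hright : ∫⁻ S, ∫⁻ s, h (S, s) ∂gammaLaw 0 ∂gammaLaw n = ∫⁻ S, ∫⁻ T, K S T := by
    rw [lintegral_gammaLaw n (Measurable.lintegral_prod_right' hh),
      ← lintegral_indicator measurableSet_Ioi]
    refine lintegral_congr fun S => ?_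
    by_cases hS : S ∈ Set.Ioi (0 : ℝ)
    · rw [Set.indicator_of_mem hS, lintegral_gammaLaw 0
        (g := fun s => h (S, s)) (hh.comp measurable_prodMk_left),
        ← lintegral_indicator measurableSet_Ioi, ← lintegral_const_mul',
        ← lintegral_sub_right_eq_self _ S]
      · refine lintegral_congr fun T => ?_
        simp only [K, Set.indicator_of_mem hS, Pi.one_apply, one_mul]
        by_cases hT : T - S ∈ Set.Ioi (0 : ℝ)
        · rw [Set.indicator_of_mem hT, Set.indicator_of_mem hT, Pi.one_apply, one_mul, ← mul_assoc,
            ← ENNReal.ofReal_mul (by have : (0 : ℝ) < S := hS; unfold gammaDensity; positivity)]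
          congr 2
          simp only [gammaDensity, pow_zero, Nat.factorial_zero, Nat.cast_one, div_one, one_mul]
          rw [mul_assoc, ← Real.exp_add]
          congr 2
          ring
        · rw [Set.indicator_of_notMem hT, Set.indicator_of_notMem hT]
          simp
      · exact ENNReal.ofReal_ne_top
    · simp [K, Set.indicator_of_notMem hS]
  have hleft : ∫⁻ T, ∫⁻ t, h (T * t, T * (1 - t)) ∂lawT (n + 1) ∂gammaLaw (n + 1)
      = ∫⁻ T, ∫⁻ S, K S T := by
    have hmeas : Measurable fun p : ℝ × ℝ => h (p.1 * p.2, p.1 * (1 - p.2)) :=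
      hh.comp (by fun_prop)
    have : IsProbabilityMeasure (lawT (n + 1)) := isProbabilityMeasure_lawT n.succ_pos
    rw [lintegral_gammaLaw (n + 1) (Measurable.lintegral_prod_right' hmeas),
      ← lintegral_indicator measurableSet_Ioi]
    refine lintegral_congr fun T => ?_
    by_cases hT : T ∈ Set.Ioi (0 : ℝ)
    · have hT0 : (0 : ℝ) < T := hT
      have himg : (fun t => T * t) '' Set.Icc 0 1 = Set.Icc 0 T := by
        rw [Set.image_mul_left_Icc hT0.le zero_le_one]
        simp
      -- Substituting `S = T t` gives `T (T t) ^ n / n! = (T ^ (n + 1) / (n + 1)!) (n + 1) t ^ n`,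
      -- the product of the Gamma and transmissivity densities up to `e^{-T}`.
      have hcv := lintegral_image_eq_lintegral_abs_deriv_mul (s := Set.Icc (0 : ℝ) 1)
        (f := fun t => T * t) (f' := fun _ => T) measurableSet_Icc
        (fun t _ => by simpa using ((hasDerivAt_id t).const_mul T).hasDerivWithinAt)
        (fun x _ y _ hxy => mul_left_cancel₀ hT0.ne' hxy)
        (fun S => ENNReal.ofReal (S ^ n / n.factorial * Real.exp (-T)) * h (S, T - S))
      have hKT : ∫⁻ S, K S T
          = ∫⁻ S in Set.Icc 0 T, ENNReal.ofReal (S ^ n / n.factorial * Real.exp (-T))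
            * h (S, T - S) := by
        rw [← setLIntegral_congr Ioo_ae_eq_Icc, ← lintegral_indicator measurableSet_Ioo]
        refine lintegral_congr fun S => ?_
        by_cases h1 : 0 < S <;> by_cases h2 : S < T <;> simp [K, Set.indicator, h1, h2]
      rw [Set.indicator_of_mem hT, hKT, ← himg, hcv, lawT, lintegral_restrict_withDensity
        (g := fun t => h (T * t, T * (1 - t))) (measurable_densityT _).ennreal_ofReal
        (hmeas.comp measurable_prodMk_left),
        ← lintegral_const_mul' _ _ ENNReal.ofReal_ne_top]
      refine setLIntegral_congr_fun measurableSet_Icc fun t ht => ?_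
      have ht0 : 0 ≤ t := ht.1
      rw [← mul_assoc, ← mul_assoc, ← ENNReal.ofReal_mul (by unfold gammaDensity; positivity),
        ← ENNReal.ofReal_mul (abs_nonneg _), abs_of_pos hT0,
        show T - T * t = T * (1 - t) by ring]
      congr 2
      simp only [gammaDensity, densityT, Nat.factorial_succ, Nat.add_sub_cancel]
      push_cast
      field_simp
      ring
    · rw [Set.indicator_of_notMem hT]
      have hT0 : T ≤ 0 := not_lt.mp hT
      symm
      rw [← lintegral_zero (μ := (volume : Measure ℝ))]
      refine lintegral_congr fun S => ?_
      by_cases h1 : 0 < S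
      · have h2 : ¬ S < T := by linarith
        simp [K, Set.indicator, h2]
      · simp [K, Set.indicator, h1]
  rw [hleft, hright]
  exact lintegral_lintegral_swap (hK.comp measurable_swap).aemeasurable

/-- The same splitting in terms of the angle of an interferometer. -/
lemma lintegral_gammaLaw_split_lawTheta (n : ℕ) {h : ℝ × ℝ → ENNReal} (hh : Measurable h) :
    ∫⁻ T, ∫⁻ θ, h (T * Real.cos (θ / 2) ^ 2, T * Real.sin (θ / 2) ^ 2) ∂lawTheta (n + 1)
        ∂gammaLaw (n + 1)
      = ∫⁻ S, ∫⁻ s, h (S, s) ∂gammaLaw 0 ∂gammaLaw n := by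
  rw [← lintegral_gammaLaw_split n hh]
  refine lintegral_congr fun T => ?_
  rw [← map_transmissivity_lawTheta n.succ_pos,
    lintegral_map (f := fun t => h (T * t, T * (1 - t))) (hh.comp (by fun_prop))
      measurable_transmissivity]
  refine lintegral_congr fun θ => ?_
  rw [transmissivity, ← Real.sin_sq]

/-! ### Product measures -/

/-- Parameters are stored by type but must be separated by layer; this exchange regroups them. -/
lemma measurePreserving_prodProdProdComm {α β γ δ : Type*} [MeasurableSpace α] [MeasurableSpace β]
    [MeasurableSpace γ] [MeasurableSpace δ] (μ : Measure α) (ν : Measure β) (ρ : Measure γ)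
    (τ : Measure δ) [SFinite μ] [SFinite ν] [SFinite ρ] [SFinite τ] :
    MeasurePreserving (fun p : (α × β) × γ × δ => ((p.1.1, p.2.1), (p.1.2, p.2.2)))
      ((μ.prod ν).prod (ρ.prod τ)) ((μ.prod ρ).prod (ν.prod τ)) := by
  have hm : Measurable fun p : (α × β) × γ × δ => ((p.1.1, p.2.1), (p.1.2, p.2.2)) := by fun_prop
  refine ⟨hm, Measure.ext_of_lintegral _ fun f hf => ?_⟩
  have h1 : Measurable fun p : (α × β) × γ × δ => f ((p.1.1, p.2.1), (p.1.2, p.2.2)) :=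
    hf.comp hm
  rw [lintegral_map hf hm, lintegral_prod _ h1.aemeasurable, lintegral_prod _ hf.aemeasurable,
    lintegral_prod _ h1.lintegral_prod_right'.aemeasurable,
    lintegral_prod _ hf.lintegral_prod_right'.aemeasurable]
  refine lintegral_congr fun a => ?_
  have h2 : ∀ b, ∫⁻ y : γ × δ, f ((a, y.1), (b, y.2)) ∂ρ.prod τ
      = ∫⁻ c, ∫⁻ d, f ((a, c), (b, d)) ∂τ ∂ρ := fun b =>
    lintegral_prod _ (hf.comp (by fun_prop)).aemeasurable
  have h3 : ∀ c, ∫⁻ y : β × δ, f ((a, c), y) ∂ν.prod τ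
      = ∫⁻ b, ∫⁻ d, f ((a, c), (b, d)) ∂τ ∂ν := fun c =>
    lintegral_prod _ (hf.comp (by fun_prop)).aemeasurable
  simp only [h2, h3]
  refine lintegral_lintegral_swap (Measurable.aemeasurable ?_)
  have h4 : Measurable fun p : (β × γ) × δ => f ((a, p.1.2), (p.1.1, p.2)) :=
    hf.comp (by fun_prop)
  exact h4.lintegral_prod_right'

lemma measurePreserving_pi_split {ι κ τ : Type*} [Fintype ι] [Fintype κ] [Fintype τ]
    (e : ι ⊕ κ ≃ τ) (μ : τ → Measure ℝ) [∀ i, SigmaFinite (μ i)] :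
    MeasurePreserving (fun f : τ → ℝ => (fun i => f (e (Sum.inl i)), fun j => f (e (Sum.inr j))))
      (Measure.pi μ)
      ((Measure.pi fun i => μ (e (Sum.inl i))).prod (Measure.pi fun j => μ (e (Sum.inr j)))) :=
  (measurePreserving_sumPiEquivProdPi fun i => μ (e i)).comp
    ((measurePreserving_piCongrLeft μ e).symm)

lemma measurePreserving_pi_last {N : ℕ} (μ : Fin (N + 1) → Measure ℝ) [∀ i, SigmaFinite (μ i)] :
    MeasurePreserving (fun f : Fin (N + 1) → ℝ => ((fun k : Fin N => f k.castSucc), f (Fin.last N)))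
      (Measure.pi μ) ((Measure.pi fun k : Fin N => μ k.castSucc).prod (μ (Fin.last N))) := by
  have h := (Measure.measurePreserving_swap).comp
    (measurePreserving_piFinSuccAbove μ (Fin.last N))
  simp only [Fin.succAbove_last] at h
  convert h using 1
  funext f
  simp [MeasurableEquiv.piFinSuccAbove, Fin.insertNthEquiv, Fin.init_def]

lemma measurePreserving_pi_zero {N : ℕ} (μ : Fin (N + 1) → Measure ℝ) [∀ i, SigmaFinite (μ i)] :
    MeasurePreserving (fun f : Fin (N + 1) → ℝ => (f 0, fun k : Fin N => f k.succ))
      (Measure.pi μ) ((μ 0).prod (Measure.pi fun k : Fin N => μ k.succ)) := by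
  have h := measurePreserving_piFinSuccAbove μ 0
  simp only [Fin.succAbove_zero] at h
  exact h

/-! ### The law of the parameters of a layer -/

instance instIsProbabilityMeasureLawThetaSucc (n : ℕ) : IsProbabilityMeasure (lawTheta (n + 1)) :=
  isProbabilityMeasure_lawTheta n.succ_pos

/-- The law of the parameters of a layer. -/
def layerLaw (N : ℕ) : Measure (LayerParams N) :=
  uniformPhase.prod
    ((Measure.pi fun k : Fin N => lawTheta (k + 1)).prod (Measure.pi fun _ => uniformPhase))

instance instIsProbabilityMeasureLayerLaw (N : ℕ) : IsProbabilityMeasure (layerLaw N) := by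
  unfold layerLaw; infer_instance

lemma measurePreserving_initLayer (N : ℕ) :
    MeasurePreserving
      (fun l : LayerParams (N + 1) => (initLayer l, l.2.1 (Fin.last N), l.2.2 (Fin.last N)))
      (layerLaw (N + 1)) ((layerLaw N).prod ((lawTheta (N + 1)).prod uniformPhase)) := by
  have hA := measurePreserving_pi_last fun k : Fin (N + 1) => lawTheta (k + 1)
  have hB := measurePreserving_pi_last fun _ : Fin (N + 1) => uniformPhase
  have h := (measurePreserving_prodProdProdComm _ _ _ _).comp (hA.prod hB)
  exact (measurePreserving_prodAssoc _ _ _).symm.comp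
    ((MeasurePreserving.id uniformPhase).prod h)

@[fun_prop] lemma measurable_layerColumn {N : ℕ} : Measurable (layerColumn (N := N)) :=
  continuous_layerColumn.measurable

@[fun_prop] lemma measurable_internalPhase : Measurable internalPhase :=
  continuous_internalPhase.measurable

/-- The law of the first column of a layer is invariant under a global phase. -/
lemma lintegral_layerLaw_smul {N : ℕ} {g : (Fin (N + 1) → ℂ) → ENNReal} (hg : Measurable g) {u : ℂ}
    (hu : ‖u‖ = 1) :
    ∫⁻ l, g (u • layerColumn l) ∂layerLaw N = ∫⁻ l, g (layerColumn l) ∂layerLaw N := by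
  have h1 : Measurable fun l : LayerParams N => g (u • layerColumn l) := hg.comp (by fun_prop)
  have h2 : Measurable fun l : LayerParams N => g (layerColumn l) := hg.comp (by fun_prop)
  -- The column depends on `γ` only through the factor `e^{iγ}`, so integrating over `γ` innermost
  -- absorbs `u`.
  rw [layerLaw, lintegral_prod_symm' _ h1, lintegral_prod_symm' _ h2]
  refine lintegral_congr fun x => ?_
  simp only [layerColumn, smul_smul, mul_comm u]
  exact lintegral_uniformPhase_mul (fun w => g (w • blockColumn x.1 x.2)) hu

/-! ### Gaussian vectors -/

/-- The density of the standard Gaussian law on `ℂⁿ`. -/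
def gaussDensity {n : ℕ} (z : Fin n → ℂ) : ENNReal :=
  ENNReal.ofReal (Real.pi⁻¹ ^ n * Real.exp (-∑ i, Complex.normSq (z i)))

/-- The standard Gaussian law on `ℂⁿ`. -/
def gaussLaw (n : ℕ) : Measure (Fin n → ℂ) := volume.withDensity gaussDensity

@[fun_prop] lemma measurable_normSq : Measurable Complex.normSq :=
  Complex.continuous_normSq.measurable

lemma measurable_gaussDensity {n : ℕ} : Measurable (gaussDensity (n := n)) := by
  unfold gaussDensity
  fun_prop

/-- The density of the standard Gaussian law on `ℂ`. -/
def gaussDensityOne (w : ℂ) : ENNReal :=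
  ENNReal.ofReal (Real.pi⁻¹ * Real.exp (-Complex.normSq w))

lemma measurable_gaussDensityOne : Measurable gaussDensityOne := by
  unfold gaussDensityOne
  fun_prop

lemma gaussDensity_cons {n : ℕ} (w : ℂ) (z : Fin n → ℂ) :
    gaussDensity (Fin.cons w z : Fin (n + 1) → ℂ) = gaussDensityOne w * gaussDensity z := by
  have hpi := Real.pi_pos
  rw [gaussDensity, gaussDensity, gaussDensityOne, ← ENNReal.ofReal_mul (by positivity),
    Fin.sum_univ_succ]
  congr 1
  simp only [Fin.cons_zero, Fin.cons_succ]
  rw [neg_add, Real.exp_add]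
  ring

lemma measurable_cons {n : ℕ} :
    Measurable fun p : ℂ × (Fin n → ℂ) => (Fin.cons p.1 p.2 : Fin (n + 1) → ℂ) := by
  refine measurable_pi_iff.mpr fun i => ?_
  refine Fin.cases ?_ (fun i => ?_) i
  · simpa using measurable_fst
  · simp only [Fin.cons_succ]
    fun_prop

lemma lintegral_volume_cons {n : ℕ} {f : (Fin (n + 1) → ℂ) → ENNReal} (hf : Measurable f) :
    ∫⁻ z, f z = ∫⁻ w : ℂ, ∫⁻ z : Fin n → ℂ, f (Fin.cons w z) := by
  have h := (volume_preserving_piFinSuccAbove (fun _ : Fin (n + 1) => ℂ) 0).symm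
  rw [← h.lintegral_comp_emb (MeasurableEquiv.measurableEmbedding _)]
  have he : ∀ p : ℂ × (Fin n → ℂ),
      (MeasurableEquiv.piFinSuccAbove (fun _ : Fin (n + 1) => ℂ) 0).symm p = Fin.cons p.1 p.2 := by
    intro p
    simp [MeasurableEquiv.piFinSuccAbove, Fin.insertNthEquiv]
  change ∫⁻ p : ℂ × (Fin n → ℂ), _ ∂(volume.prod volume) = _
  rw [← lintegral_prod (μ := volume) (ν := volume) (fun p : ℂ × (Fin n → ℂ) => f (Fin.cons p.1 p.2))
    (hf.comp measurable_cons).aemeasurable]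
  exact lintegral_congr fun p => by rw [he]

lemma lintegral_gaussLaw_cons {n : ℕ} {f : (Fin (n + 1) → ℂ) → ENNReal} (hf : Measurable f) :
    ∫⁻ z, f z ∂gaussLaw (n + 1)
      = ∫⁻ w : ℂ, gaussDensityOne w * ∫⁻ z, f (Fin.cons w z) ∂gaussLaw n := by
  rw [gaussLaw, lintegral_withDensity_eq_lintegral_mul _ measurable_gaussDensity hf,
    lintegral_volume_cons (measurable_gaussDensity.mul hf)]
  refine lintegral_congr fun w => ?_
  have hfw : Measurable fun z : Fin n → ℂ => f (Fin.cons w z) :=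
    hf.comp (measurable_cons.comp measurable_prodMk_left)
  rw [gaussLaw, lintegral_withDensity_eq_lintegral_mul _ measurable_gaussDensity hfw,
    ← lintegral_const_mul' (gaussDensityOne w) _ ENNReal.ofReal_ne_top]
  refine lintegral_congr fun z => ?_
  simp only [Pi.mul_apply, gaussDensity_cons, mul_assoc]

/-- The modulus and the phase of a complex Gaussian variable. -/
lemma lintegral_gaussDensityOne {f : ℂ → ENNReal} (hf : Measurable f) :
    ∫⁻ w : ℂ, gaussDensityOne w * f w
      = ∫⁻ s, ∫⁻ φ, f ((Real.sqrt s : ℂ) * Complex.exp (Complex.I * (φ : ℝ))) ∂uniformPhase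
          ∂gammaLaw 0 := by
  let k : ℝ → ENNReal := fun r =>
    ∫⁻ φ, f ((r : ℂ) * Complex.exp (Complex.I * (φ : ℝ))) ∂uniformPhase
  have hk : Measurable k := by
    have : Measurable fun p : ℝ × ℝ => f ((p.1 : ℂ) * Complex.exp (Complex.I * (p.2 : ℝ))) :=
      hf.comp (by fun_prop)
    exact this.lintegral_prod_right'
  have hpi := Real.pi_pos
  -- The substitution `s = r²` turns the exponential law of the squared modulus into the radial
  -- density `2 r e^{-r²}`, as obtained from polar coordinates.
  have hright : ∫⁻ s, k (Real.sqrt s) ∂gammaLaw 0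
      = ∫⁻ r in Set.Ioi 0, ENNReal.ofReal (2 * r * Real.exp (-r ^ 2)) * k r := by
    rw [lintegral_gammaLaw 0 (g := fun s => k (Real.sqrt s)) (hk.comp (by fun_prop))]
    have himg : (fun r : ℝ => r ^ 2) '' Set.Ioi 0 = Set.Ioi 0 := by
      apply Set.Subset.antisymm
      · rintro _ ⟨r, hr, rfl⟩
        exact pow_pos (Set.mem_Ioi.mp hr) 2
      · exact fun s hs => ⟨Real.sqrt s, Real.sqrt_pos.mpr hs, Real.sq_sqrt (le_of_lt hs)⟩
    have hcv := lintegral_image_eq_lintegral_abs_deriv_mul (s := Set.Ioi (0 : ℝ))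
      (f := fun r => r ^ 2) (f' := fun r => 2 * r) measurableSet_Ioi
      (fun t _ => by simpa using (hasDerivAt_pow 2 t).hasDerivWithinAt)
      (fun x hx y hy hxy => (pow_left_inj₀ (le_of_lt hx) (le_of_lt hy) two_ne_zero).mp hxy)
      (fun s => ENNReal.ofReal (gammaDensity 0 s) * k (Real.sqrt s))
    rw [himg] at hcv
    rw [hcv]
    refine setLIntegral_congr_fun measurableSet_Ioi fun r hr => ?_
    have hr0 : (0 : ℝ) < r := hr
    simp only [Real.sqrt_sq hr0.le]
    rw [← mul_assoc, ← ENNReal.ofReal_mul (abs_nonneg _), abs_of_pos (by positivity)]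
    simp [gammaDensity]
  change _ = ∫⁻ s, k (Real.sqrt s) ∂gammaLaw 0
  rw [hright, ← Complex.lintegral_comp_polarCoord_symm, polarCoord_target]
  have hpolar : ∀ p : ℝ × ℝ,
      Complex.polarCoord.symm p = (p.1 : ℂ) * Complex.exp (Complex.I * (p.2 : ℝ)) := by
    intro p
    rw [Complex.polarCoord_symm_apply, mul_comm Complex.I, Complex.exp_mul_I]
    push_cast
    rfl
  have hms : Measurable fun p : ℝ × ℝ => ENNReal.ofReal p.1 •
      (gaussDensityOne ((p.1 : ℂ) * Complex.exp (Complex.I * (p.2 : ℝ)))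
        * f ((p.1 : ℂ) * Complex.exp (Complex.I * (p.2 : ℝ)))) := by
    have h1 : Measurable fun p : ℝ × ℝ => (p.1 : ℂ) * Complex.exp (Complex.I * (p.2 : ℝ)) := by
      fun_prop
    exact (measurable_fst.ennreal_ofReal).mul
      ((measurable_gaussDensityOne.comp h1).mul (hf.comp h1))
  simp only [hpolar]
  rw [Measure.volume_eq_prod, ← Measure.prod_restrict, lintegral_prod _ hms.aemeasurable]
  refine setLIntegral_congr_fun measurableSet_Ioi fun r hr => ?_
  have hr0 : (0 : ℝ) < r := hr
  have hnorm : ∀ x : ℝ, Complex.normSq ((r : ℂ) * Complex.exp (Complex.I * (x : ℝ))) = r ^ 2 := by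
    intro x
    rw [Complex.normSq_eq_norm_sq, norm_mul, norm_exp_I_mul, mul_one, Complex.norm_real,
      Real.norm_of_nonneg hr0.le]
  have hper : Function.Periodic
      (fun x : ℝ => f ((r : ℂ) * Complex.exp (Complex.I * (x : ℝ)))) (2 * Real.pi) :=
    periodic_exp_I_mul.comp fun w => f ((r : ℂ) * w)
  simp only [gaussDensityOne, hnorm, smul_eq_mul, k]
  rw [lintegral_uniformPhase hper (-Real.pi), setLIntegral_congr Ioo_ae_eq_Ioc,
    show -Real.pi + 2 * Real.pi = Real.pi by ring]
  simp only [← mul_assoc]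
  rw [lintegral_const_mul' _ _ (ENNReal.mul_ne_top ENNReal.ofReal_ne_top ENNReal.ofReal_ne_top),
    ← ENNReal.ofReal_inv_of_pos (by positivity), ← ENNReal.ofReal_mul hr0.le,
    ← ENNReal.ofReal_mul (by positivity)]
  congr 2
  field_simp

lemma lintegral_gaussLaw_zero (g : (Fin 0 → ℂ) → ENNReal) :
    ∫⁻ z, g z ∂gaussLaw 0 = g Fin.elim0 := by
  have h1 : gaussDensity (n := 0) = 1 := by
    funext z
    simp [gaussDensity]
  rw [gaussLaw, h1, withDensity_one, volume_pi, Measure.pi_of_empty _ Fin.elim0, lintegral_dirac]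

/-- A Gaussian vector is an independent Gamma radius times the first column of a random layer. -/
lemma lintegral_gaussLaw_eq (N : ℕ) {f : (Fin (N + 1) → ℂ) → ENNReal} (hf : Measurable f) :
    ∫⁻ S, ∫⁻ l, f ((Real.sqrt S : ℂ) • layerColumn l) ∂layerLaw N ∂gammaLaw N
      = ∫⁻ z, f z ∂gaussLaw (N + 1) := by
  induction N with
  | zero =>
    rw [lintegral_gaussLaw_cons hf]
    simp only [lintegral_gaussLaw_zero]
    rw [lintegral_gaussDensityOne (f := fun w => f (Fin.cons w Fin.elim0))
      (hf.comp (measurable_cons.comp measurable_prodMk_right))]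
    refine lintegral_congr fun S => ?_
    have hm : Measurable fun l : LayerParams 0 => f ((Real.sqrt S : ℂ) • layerColumn l) :=
      hf.comp (by fun_prop)
    rw [layerLaw, lintegral_prod _ hm.aemeasurable]
    refine lintegral_congr fun φ => ?_
    have h : ∀ x : (Fin 0 → ℝ) × (Fin 0 → ℝ),
        (Real.sqrt S : ℂ) • layerColumn ((φ, x) : LayerParams 0)
          = Fin.cons ((Real.sqrt S : ℂ) * Complex.exp (Complex.I * φ)) Fin.elim0 := by
      intro x
      rw [layerColumn_zero]
      funext i
      rw [show i = 0 from Fin.fin_one_eq_zero i]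
      simp
    simp [h]
  | succ N ih =>
    let J : ℝ → ℝ → ℝ → LayerParams N → ENNReal := fun S s φ l =>
      f (Fin.cons ((Real.sqrt s : ℂ) * Complex.exp (Complex.I * (φ : ℝ)))
        ((Real.sqrt S : ℂ) • layerColumn l))
    have hJ : Measurable fun p : ((ℝ × ℝ) × ℝ) × LayerParams N =>
        J p.1.1.1 p.1.1.2 p.1.2 p.2 := by
      refine hf.comp (measurable_cons.comp (Measurable.prodMk ?_ ?_)) <;> fun_prop
    -- The two arguments are the squared norms of the tail and of the first entry.
    let H : ℝ × ℝ → ENNReal := fun p => ∫⁻ φ, ∫⁻ l, J p.1 p.2 φ l ∂layerLaw N ∂uniformPhase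
    have hH : Measurable H := hJ.lintegral_prod_right'.lintegral_prod_right'
    have hright : ∫⁻ z, f z ∂gaussLaw (N + 2) = ∫⁻ S, ∫⁻ s, H (S, s) ∂gammaLaw 0 ∂gammaLaw N := by
      have hcons : ∀ w : ℂ, ∫⁻ z, f (Fin.cons w z) ∂gaussLaw (N + 1)
          = ∫⁻ S, ∫⁻ l, f (Fin.cons w ((Real.sqrt S : ℂ) • layerColumn l)) ∂layerLaw N
            ∂gammaLaw N := fun w =>
        (ih (f := fun z => f (Fin.cons w z))
          (hf.comp (measurable_cons.comp measurable_prodMk_left))).symm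
      rw [lintegral_gaussLaw_cons hf]
      simp only [hcons]
      rw [lintegral_gaussDensityOne (f := fun w => ∫⁻ S, ∫⁻ l,
        f (Fin.cons w ((Real.sqrt S : ℂ) • layerColumn l)) ∂layerLaw N ∂gammaLaw N)]
      · rw [lintegral_lintegral_swap (f := fun S s => H (S, s)) hH.aemeasurable]
        refine lintegral_congr fun s => ?_
        refine lintegral_lintegral_swap (Measurable.aemeasurable ?_)
        have h1 : Measurable fun p : (ℝ × ℝ) × LayerParams N => J p.1.2 s p.1.1 p.2 :=
          hJ.comp (f := fun p : (ℝ × ℝ) × LayerParams N => (((p.1.2, s), p.1.1), p.2))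
            (by fun_prop)
        exact h1.lintegral_prod_right'
      · have h1 : Measurable fun p : (ℂ × ℝ) × LayerParams N =>
            f (Fin.cons p.1.1 ((Real.sqrt p.1.2 : ℂ) • layerColumn p.2)) := by
          refine hf.comp (measurable_cons.comp (Measurable.prodMk ?_ ?_)) <;> fun_prop
        exact h1.lintegral_prod_right'.lintegral_prod_right'
    -- The last interferometer performs the Gamma split: the total `T` becomes `T cos² (θ / 2)` in
    -- the tail and `T sin² (θ / 2)` in the first entry.
    rw [hright, ← lintegral_gammaLaw_split_lawTheta N hH]
    refine lintegral_congr fun T => ?_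
    let F : LayerParams N × ℝ × ℝ → ENNReal := fun p =>
      f (Fin.cons (Complex.exp (Complex.I * p.2.2)
          * (Complex.exp (Complex.I * p.1.1) * internalPhase p.2.1)
          * (Real.sqrt T * Real.sin (p.2.1 / 2) : ℝ))
        ((Real.sqrt T * Real.cos (p.2.1 / 2) : ℝ) • internalPhase p.2.1 • layerColumn p.1))
    have hF : Measurable F := by
      refine hf.comp (measurable_cons.comp (Measurable.prodMk ?_ ?_)) <;> fun_prop
    have hmp := measurePreserving_initLayer N
    have hsplit : ∫⁻ l, f ((Real.sqrt T : ℂ) • layerColumn l) ∂layerLaw (N + 1)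
        = ∫⁻ p, F p ∂(layerLaw N).prod ((lawTheta (N + 1)).prod uniformPhase) := by
      rw [← hmp.map_eq, lintegral_map hF hmp.measurable]
      refine lintegral_congr fun l => congrArg f ?_
      rw [layerColumn_succ]
      ext i
      refine Fin.cases ?_ (fun i => ?_) i
      · simp only [Pi.smul_apply, Fin.cons_zero, smul_eq_mul, initLayer]
        push_cast
        ring
      · simp only [Pi.smul_apply, Fin.cons_succ, smul_eq_mul, Complex.real_smul]
        push_cast
        ring
    rw [hsplit, lintegral_prod_symm' _ hF, lintegral_prod _ hF.lintegral_prod_left'.aemeasurable]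
    refine lintegral_congr_ae ?_
    filter_upwards [ae_mem_of_restrict_withDensity measurableSet_Icc _] with θ hθ
    have hc : Real.sqrt (T * Real.cos (θ / 2) ^ 2) = Real.sqrt T * Real.cos (θ / 2) := by
      rw [Real.sqrt_mul' _ (sq_nonneg _), Real.sqrt_sq (cos_half_nonneg hθ)]
    have hs : Real.sqrt (T * Real.sin (θ / 2) ^ 2) = Real.sqrt T * Real.sin (θ / 2) := by
      rw [Real.sqrt_mul' _ (sq_nonneg _), Real.sqrt_sq (sin_half_nonneg hθ)]
    have hFθ : Measurable fun p : LayerParams N × ℝ => F (p.1, (θ, p.2)) := hF.comp (by fun_prop)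
    let F' : LayerParams N → ℝ → ENNReal := fun l φ =>
      f (Fin.cons (Complex.exp (Complex.I * φ) * (Real.sqrt T * Real.sin (θ / 2) : ℝ))
        ((Real.sqrt T * Real.cos (θ / 2) : ℝ) • internalPhase θ • layerColumn l))
    have hF' : Measurable (Function.uncurry F') := by
      refine hf.comp (measurable_cons.comp (Measurable.prodMk ?_ ?_)) <;> fun_prop
    -- The unwanted phases are removed one at a time. With `l` fixed, the uniform `φ` absorbs
    -- `e^{iγ}` and the internal phase in the first entry; with `φ` fixed, the uniform `γ` inside
    -- `l` absorbs the internal phase on the tail.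
    calc ∫⁻ φ, ∫⁻ l, F (l, (θ, φ)) ∂layerLaw N ∂uniformPhase
        = ∫⁻ l, ∫⁻ φ, F (l, (θ, φ)) ∂uniformPhase ∂layerLaw N :=
          (lintegral_lintegral_swap (f := fun l φ => F (l, (θ, φ))) hFθ.aemeasurable).symm
      _ = ∫⁻ l, ∫⁻ φ, F' l φ ∂uniformPhase ∂layerLaw N := by
          refine lintegral_congr fun l => ?_
          have hu : ‖Complex.exp (Complex.I * l.1) * internalPhase θ‖ = 1 := by
            rw [norm_mul, norm_exp_I_mul, norm_internalPhase, one_mul]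
          exact lintegral_uniformPhase_mul (fun w => f (Fin.cons
            (w * (Real.sqrt T * Real.sin (θ / 2) : ℝ))
            ((Real.sqrt T * Real.cos (θ / 2) : ℝ) • internalPhase θ • layerColumn l)))
            hu
      _ = ∫⁻ φ, ∫⁻ l, F' l φ ∂layerLaw N ∂uniformPhase :=
          lintegral_lintegral_swap hF'.aemeasurable
      _ = H (T * Real.cos (θ / 2) ^ 2, T * Real.sin (θ / 2) ^ 2) := by
          refine lintegral_congr fun φ => ?_
          refine (lintegral_layerLaw_smul (g := fun z => f (Fin.cons
            (Complex.exp (Complex.I * φ) * (Real.sqrt T * Real.sin (θ / 2) : ℝ))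
            ((Real.sqrt T * Real.cos (θ / 2) : ℝ) • z))) ?_ (norm_internalPhase θ)).trans ?_
          · exact hf.comp (measurable_cons.comp
              (Measurable.prodMk measurable_const (by fun_prop)))
          · refine lintegral_congr fun l => congrArg f ?_
            simp only [hc, hs]
            rw [mul_comm (Complex.exp _)]
            congr 1

/-- Testing the Gamma representation against the constant `1` gives the normalization without a
Gaussian integral. -/
lemma isProbabilityMeasure_gaussLaw (N : ℕ) : IsProbabilityMeasure (gaussLaw (N + 1)) := by
  have h := lintegral_gaussLaw_eq N (measurable_const (a := (1 : ENNReal)))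
  simp only [lintegral_one, measure_univ] at h
  exact ⟨h.symm⟩

@[fun_prop] lemma measurable_mulVec {n : ℕ} (A : Matrix (Fin n) (Fin n) ℂ) :
    Measurable (Matrix.mulVec A) := by
  have : Continuous (Matrix.mulVec A) := continuous_const.matrix_mulVec continuous_id
  exact this.measurable

/-- The Gaussian law is invariant under unitary matrices. -/
lemma lintegral_gaussLaw_mulVec {N : ℕ} (U : UnitaryN (N + 1))
    {f : (Fin (N + 1) → ℂ) → ENNReal} (hf : Measurable f) :
    ∫⁻ z, f (Matrix.mulVec U.1 z) ∂gaussLaw (N + 1) = ∫⁻ z, f z ∂gaussLaw (N + 1) := by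
  let L : UnitaryN (N + 1) → (Fin (N + 1) → ℂ) →ₗ[ℝ] Fin (N + 1) → ℂ := fun V =>
    (Matrix.mulVecLin V.1).restrictScalars ℝ
  have hL : ∀ V z, L V z = Matrix.mulVec V.1 z := fun _ _ => rfl
  have hdet : LinearMap.det (L U) ≠ 0 := by
    have hcomp : L U ∘ₗ L U⁻¹ = LinearMap.id := by
      refine LinearMap.ext fun z => ?_
      rw [LinearMap.comp_apply, hL, hL, Matrix.mulVec_mulVec]
      have : U.1 * (U⁻¹).1 = 1 := congrArg Subtype.val (mul_inv_cancel U)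
      rw [this, Matrix.one_mulVec]
      rfl
    have h := congrArg LinearMap.det hcomp
    rw [LinearMap.det_comp, LinearMap.det_id] at h
    exact left_ne_zero_of_mul_eq_one h
  have hmap := Measure.map_linearMap_addHaar_eq_smul_addHaar
    (volume : Measure (Fin (N + 1) → ℂ)) hdet
  set c : ENNReal := ENNReal.ofReal |(LinearMap.det (L U))⁻¹|
  have hdens : ∀ z, gaussDensity (Matrix.mulVec U.1 z) = gaussDensity z := by
    intro z
    rw [gaussDensity, gaussDensity, sum_normSq_mulVec]
  -- A linear change of variables costs only a constant, because the density depends on the norm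
  -- alone. The constant is then `1` because the total mass is, so the real determinant need not be
  -- computed.
  have key : ∀ g : (Fin (N + 1) → ℂ) → ENNReal, Measurable g →
      ∫⁻ z, g (Matrix.mulVec U.1 z) ∂gaussLaw (N + 1) = c * ∫⁻ z, g z ∂gaussLaw (N + 1) := by
    intro g hg
    have hgU : Measurable fun z => g (Matrix.mulVec U.1 z) := hg.comp (measurable_mulVec U.1)
    rw [gaussLaw, lintegral_withDensity_eq_lintegral_mul _ measurable_gaussDensity hg,
      lintegral_withDensity_eq_lintegral_mul _ measurable_gaussDensity hgU, ← smul_eq_mul c,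
      ← lintegral_smul_measure, ← hmap, lintegral_map (g := L U) (measurable_gaussDensity.mul hg)
        (measurable_mulVec U.1)]
    refine lintegral_congr fun z => ?_
    simp only [Pi.mul_apply, hL, hdens]
  have hprob := isProbabilityMeasure_gaussLaw N
  have hc : c = 1 := by
    have h := key (fun _ => 1) measurable_const
    simpa using h.symm
  rw [key f hf, hc, one_mul]

/-- The direction of a vector. -/
def direction {n : ℕ} (z : Fin n → ℂ) : Fin n → ℂ :=
  (Real.sqrt (∑ i, Complex.normSq (z i)))⁻¹ • z

lemma measurable_direction {n : ℕ} : Measurable (direction (n := n)) := by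
  unfold direction
  fun_prop

lemma direction_mulVec {n : ℕ} (U : UnitaryN n) (z : Fin n → ℂ) :
    direction (Matrix.mulVec U.1 z) = Matrix.mulVec U.1 (direction z) := by
  rw [direction, direction, sum_normSq_mulVec, Matrix.mulVec_smul]

lemma direction_smul_layerColumn {N : ℕ} (l : LayerParams N) {S : ℝ} (hS : 0 < S) :
    direction ((Real.sqrt S : ℂ) • layerColumn l) = layerColumn l := by
  have h : ∑ i, Complex.normSq (((Real.sqrt S : ℂ) • layerColumn l) i) = S := by
    simp only [Pi.smul_apply, smul_eq_mul, map_mul, ← Finset.mul_sum, sum_normSq_layerColumn,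
      Complex.normSq_ofReal, mul_one, Real.mul_self_sqrt hS.le]
  rw [direction, h]
  ext i
  have : (Real.sqrt S : ℂ) ≠ 0 := Complex.ofReal_ne_zero.mpr (Real.sqrt_pos.mpr hS).ne'
  simp only [Pi.smul_apply, smul_eq_mul, Complex.real_smul]
  push_cast
  field_simp

/-- The first column of a random layer is the direction of a Gaussian vector. -/
lemma lintegral_layerColumn_eq {N : ℕ} {f : (Fin (N + 1) → ℂ) → ENNReal} (hf : Measurable f) :
    ∫⁻ l, f (layerColumn l) ∂layerLaw N = ∫⁻ z, f (direction z) ∂gaussLaw (N + 1) := by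
  rw [← lintegral_gaussLaw_eq N (f := fun z => f (direction z)) (hf.comp measurable_direction)]
  have h : ∀ᵐ S ∂gammaLaw N,
      ∫⁻ l, f (direction ((Real.sqrt S : ℂ) • layerColumn l)) ∂layerLaw N
        = ∫⁻ l, f (layerColumn l) ∂layerLaw N := by
    rw [gammaLaw_eq]
    filter_upwards [ae_mem_of_restrict_withDensity measurableSet_Ioi _] with S hS
    exact lintegral_congr fun l => by rw [direction_smul_layerColumn l hS]
  rw [lintegral_congr_ae h, lintegral_const, measure_univ, mul_one]

/-- The law of the first column of a random layer is invariant under unitary matrices. -/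
lemma lintegral_layerColumn_mulVec {N : ℕ} (U : UnitaryN (N + 1))
    {f : (Fin (N + 1) → ℂ) → ENNReal} (hf : Measurable f) :
    ∫⁻ l, f (Matrix.mulVec U.1 (layerColumn l)) ∂layerLaw N
      = ∫⁻ l, f (layerColumn l) ∂layerLaw N := by
  rw [lintegral_layerColumn_eq (f := fun z => f (Matrix.mulVec U.1 z))
    (hf.comp (measurable_mulVec U.1)), lintegral_layerColumn_eq hf]
  simp only [← direction_mulVec]
  exact lintegral_gaussLaw_mulVec U (f := fun z => f (direction z)) (hf.comp measurable_direction)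

/-! ### Haar measure and the first column -/

instance instSecondCountableTopologyUnitaryN (N : ℕ) : SecondCountableTopology (UnitaryN N) := by
  have : SecondCountableTopology (Matrix (Fin N) (Fin N) ℂ) :=
    inferInstanceAs (SecondCountableTopology (Fin N → Fin N → ℂ))
  exact TopologicalSpace.Subtype.secondCountableTopology _

instance instIsHaarMeasureHaarU (N : ℕ) : (haarU N).IsHaarMeasure := by
  unfold haarU; infer_instance

instance instIsProbabilityMeasureHaarU (N : ℕ) : IsProbabilityMeasure (haarU N) :=
  ⟨by simpa [haarU] using
    Measure.haarMeasure_self (K₀ := (⊤ : TopologicalSpace.PositiveCompacts (UnitaryN N)))⟩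

/-- A right translate of Haar measure is again a left-invariant probability measure, so uniqueness
identifies the two. -/
instance instIsMulRightInvariantHaarU (N : ℕ) : (haarU N).IsMulRightInvariant := by
  refine ⟨fun g => ?_⟩
  have : IsProbabilityMeasure (Measure.map (· * g) (haarU N)) :=
    Measure.isProbabilityMeasure_map (by fun_prop)
  have : (Measure.map (· * g) (haarU N)).IsHaarMeasure := Measure.isHaarMeasure_map_mul_right _ g
  exact Measure.isHaarMeasure_eq_of_isProbabilityMeasure _ _

lemma measurable_firstColumn {N : ℕ} : Measurable (firstColumn (N := N)) :=
  continuous_firstColumn.measurable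

lemma measurable_layerUnitary {N : ℕ} : Measurable (layerUnitary (N := N)) :=
  continuous_layerUnitary.measurable

lemma measurable_embedUnitary {N : ℕ} : Measurable (embedUnitary (N := N)) :=
  continuous_embedUnitary.measurable

/-- The first column of a Haar random unitary has the law of the first column of a random
layer. -/
lemma lintegral_firstColumn {N : ℕ} {f : (Fin (N + 1) → ℂ) → ENNReal} (hf : Measurable f) :
    ∫⁻ U, f (firstColumn U) ∂haarU (N + 1) = ∫⁻ l, f (layerColumn l) ∂layerLaw N := by
  have hm : Measurable (Function.uncurry fun (V : UnitaryN (N + 1)) (l : LayerParams N) =>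
      f (firstColumn (V * layerUnitary l))) :=
    hf.comp (measurable_firstColumn.comp
      (measurable_fst.mul (measurable_layerUnitary.comp measurable_snd)))
  -- The product `V * L` of a Haar unitary and an independent random layer is averaged in both
  -- orders: Haar measure absorbs `L` by right invariance, and the law of the column of `L` absorbs
  -- `V`.
  calc ∫⁻ U, f (firstColumn U) ∂haarU (N + 1)
      = ∫⁻ l, ∫⁻ V, f (firstColumn (V * layerUnitary l)) ∂haarU (N + 1) ∂layerLaw N := by
        have h : ∀ l : LayerParams N, ∫⁻ V, f (firstColumn (V * layerUnitary l)) ∂haarU (N + 1)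
            = ∫⁻ V, f (firstColumn V) ∂haarU (N + 1) := fun l =>
          lintegral_mul_right_eq_self (fun V => f (firstColumn V)) (layerUnitary l)
        simp only [h, lintegral_const, measure_univ, mul_one]
    _ = ∫⁻ V, ∫⁻ l, f (firstColumn (V * layerUnitary l)) ∂layerLaw N ∂haarU (N + 1) :=
        (lintegral_lintegral_swap hm.aemeasurable).symm
    _ = ∫⁻ l, f (layerColumn l) ∂layerLaw N := by
        simp only [firstColumn_mul, firstColumn_layerUnitary]
        have h : ∀ V : UnitaryN (N + 1), ∫⁻ l, f (Matrix.mulVec V.1 (layerColumn l)) ∂layerLaw N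
            = ∫⁻ l, f (layerColumn l) ∂layerLaw N := fun V => lintegral_layerColumn_mulVec V hf
        simp only [h, lintegral_const, measure_univ, mul_one]

/-! ### The interior has full measure -/

lemma ae_lawTheta (α : ℕ) : ∀ᵐ θ ∂lawTheta α, θ ∈ Set.Ioo 0 Real.pi := by
  have h : lawTheta α = (volume.restrict (Set.Ioo 0 Real.pi)).withDensity
      fun θ => ENNReal.ofReal (densityTheta α θ) := by
    rw [lawTheta, Measure.restrict_congr_set Ioo_ae_eq_Icc]
  rw [h]
  exact ae_mem_of_restrict_withDensity measurableSet_Ioo _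

lemma ae_uniformPhase : ∀ᵐ φ ∂uniformPhase, φ ∈ Set.Ico 0 (2 * Real.pi) :=
  ProbabilityTheory.ae_cond_mem measurableSet_Ico

lemma ae_pi_mem {ι : Type*} [Fintype ι] {μ : ι → Measure ℝ} [∀ i, IsProbabilityMeasure (μ i)]
    {s : Set ℝ} (h : ∀ i, ∀ᵐ x ∂μ i, x ∈ s) : ∀ᵐ f ∂Measure.pi μ, ∀ i, f i ∈ s :=
  ae_all_iff.mpr fun i => (measurePreserving_eval μ i).quasiMeasurePreserving.ae (h i)

lemma ae_prod_and {α β : Type*} [MeasurableSpace α] [MeasurableSpace β] {μ : Measure α}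
    {ν : Measure β} {p : α → Prop} {q : β → Prop} (hp : ∀ᵐ x ∂μ, p x)
    (hq : ∀ᵐ y ∂ν, q y) : ∀ᵐ z ∂μ.prod ν, p z.1 ∧ q z.2 :=
  (Measure.quasiMeasurePreserving_fst.ae hp).and (Measure.quasiMeasurePreserving_snd.ae hq)

lemma ae_layerLaw (N : ℕ) : ∀ᵐ l ∂layerLaw N, l ∈ layerInterior N :=
  ae_prod_and ae_uniformPhase (ae_prod_and (ae_pi_mem fun _ => ae_lawTheta _)
    (ae_pi_mem fun _ => ae_uniformPhase))

lemma measurableSet_layerInterior (N : ℕ) : MeasurableSet (layerInterior N) := by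
  refine (measurableSet_Ico.preimage measurable_fst).inter
    (MeasurableSet.inter (s₁ := {l : LayerParams N | ∀ k, l.2.1 k ∈ Set.Ioo 0 Real.pi})
      (s₂ := {l : LayerParams N | ∀ k, l.2.2 k ∈ Set.Ico 0 (2 * Real.pi)}) ?_ ?_)
  · exact measurableSet_setOfPred.mpr (Measurable.forall fun k =>
      measurableSet_setOfPred.mp (measurableSet_Ioo.preimage (by fun_prop)))
  · exact measurableSet_setOfPred.mpr (Measurable.forall fun k =>
      measurableSet_setOfPred.mp (measurableSet_Ico.preimage (by fun_prop)))

/-- An injective measurable map on a measurable set has a measurable left inverse. -/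
lemma exists_measurable_leftInverse {X Y : Type*} [MeasurableSpace X] [StandardBorelSpace X]
    [Inhabited X] [TopologicalSpace Y] [T2Space Y] [SecondCountableTopology Y] [MeasurableSpace Y]
    [OpensMeasurableSpace Y] {f : X → Y} (hf : Measurable f) {s : Set X} (hs : MeasurableSet s)
    (hinj : Set.InjOn f s) : ∃ g : Y → X, Measurable g ∧ ∀ x ∈ s, g (f x) = x := by
  have : StandardBorelSpace s := hs.standardBorel
  -- By the Lusin–Souslin theorem, an injective measurable map out of a standard Borel space carries
  -- measurable sets to measurable sets.
  have hemb : MeasurableEmbedding (fun x : s => f x) :=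
    (hf.comp measurable_subtype_coe).measurableEmbedding (Set.injOn_iff_injective.mp hinj)
  refine ⟨Function.extend (fun x : s => f x) Subtype.val fun _ => default,
    hemb.measurable_extend measurable_subtype_coe measurable_const, fun x hx => ?_⟩
  exact hemb.injective.extend_apply _ _ ⟨x, hx⟩

/-- A function of a unitary matrix that only depends on its first column has the same mean for
Haar measure and for a random layer. -/
lemma lintegral_haarU_of_invariant {N : ℕ} {F : UnitaryN (N + 1) → ENNReal} (hF : Measurable F)
    (hinv : ∀ U V, F (U * embedUnitary V) = F U) :
    ∫⁻ U, F U ∂haarU (N + 1) = ∫⁻ l, F (layerUnitary l) ∂layerLaw N := by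
  obtain ⟨g, hg, hgl⟩ := exists_measurable_leftInverse (measurable_layerColumn (N := N))
    (measurableSet_layerInterior N)
    (fun l hl l' hl' h => layerColumn_inj hl (layerInterior_subset N hl') h)
  have hcol : ∀ U V : UnitaryN (N + 1), firstColumn U = firstColumn V → F U = F V := by
    intro U V h
    obtain ⟨W, rfl⟩ := exists_mul_embedUnitary h
    exact hinv V W
  let A : Set (Fin (N + 1) → ℂ) := {z | layerColumn (g z) = z}
  have hA : MeasurableSet A := measurableSet_eq_fun (measurable_layerColumn.comp hg) measurable_id
  -- The set of columns from which `g` recovers a layer is full for random layers, hence for Haar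
  -- columns, since the two laws agree.
  have hae : ∀ᵐ U ∂haarU (N + 1), layerColumn (g (firstColumn U)) = firstColumn U := by
    let χ : (Fin (N + 1) → ℂ) → ENNReal := Aᶜ.indicator 1
    have hχ : Measurable χ := measurable_one.indicator hA.compl
    have h0 : ∫⁻ l, χ (layerColumn l) ∂layerLaw N = 0 := by
      rw [← lintegral_zero (μ := layerLaw N)]
      refine lintegral_congr_ae ?_
      filter_upwards [ae_layerLaw N] with l hl
      have hmem : layerColumn l ∈ A := by
        change layerColumn (g (layerColumn l)) = layerColumn l
        rw [hgl l hl]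
      simp [χ, hmem]
    rw [← lintegral_firstColumn hχ] at h0
    have hχc : Measurable fun U : UnitaryN (N + 1) => χ (firstColumn U) :=
      hχ.comp measurable_firstColumn
    filter_upwards [(lintegral_eq_zero_iff hχc).mp h0] with U hU
    by_contra hne
    have hmem : firstColumn U ∈ Aᶜ := hne
    simp [χ, hmem] at hU
  have hFg : Measurable fun z => F (layerUnitary (g z)) :=
    hF.comp (measurable_layerUnitary.comp hg)
  calc ∫⁻ U, F U ∂haarU (N + 1)
      = ∫⁻ U, F (layerUnitary (g (firstColumn U))) ∂haarU (N + 1) := by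
        refine lintegral_congr_ae ?_
        filter_upwards [hae] with U hU
        exact hcol _ _ (by rw [firstColumn_layerUnitary, hU])
    _ = ∫⁻ l, F (layerUnitary (g (layerColumn l))) ∂layerLaw N := lintegral_firstColumn hFg
    _ = ∫⁻ l, F (layerUnitary l) ∂layerLaw N := by
        refine lintegral_congr_ae ?_
        filter_upwards [ae_layerLaw N] with l hl
        rw [hgl l hl]

/-- Haar measure of `U(N + 1)` is the law of a random layer times a Haar random element of
`U(N)`. -/
lemma lintegral_haarU_succ {N : ℕ} {f : UnitaryN (N + 1) → ENNReal} (hf : Measurable f) :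
    ∫⁻ U, f U ∂haarU (N + 1)
      = ∫⁻ l, ∫⁻ V, f (layerUnitary l * embedUnitary V) ∂haarU N ∂layerLaw N := by
  have hm : Measurable fun p : UnitaryN (N + 1) × UnitaryN N => f (p.1 * embedUnitary p.2) :=
    hf.comp (measurable_fst.mul (measurable_embedUnitary.comp measurable_snd))
  -- Averaging `f` over the embedded subgroup makes it a function of the first column, by left
  -- invariance on `U(N)`. Its Haar mean is still that of `f`, by right invariance on `U(N + 1)`.
  rw [← lintegral_haarU_of_invariant (F := fun U => ∫⁻ V, f (U * embedUnitary V) ∂haarU N)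
    hm.lintegral_prod_right', lintegral_lintegral_swap hm.aemeasurable]
  · have h : ∀ V : UnitaryN N, ∫⁻ U, f (U * embedUnitary V) ∂haarU (N + 1)
        = ∫⁻ U, f U ∂haarU (N + 1) := fun V => lintegral_mul_right_eq_self f (embedUnitary V)
    simp only [h, lintegral_const, measure_univ, mul_one]
  · intro U W
    simp only [mul_assoc, ← embedUnitary_mul]
    exact lintegral_mul_left_eq_self (fun V => f (U * embedUnitary V)) W

/-! ### The law of the mesh -/

/-- The index depends only on the position within the layer, so passing to a smaller mesh changes no
law; this is what makes the induction on `N` close. -/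
lemma sensitivity_eq {N : ℕ} (p : MZI N) : sensitivity p = p.2 + 1 := by
  have h1 := p.2.2
  have h2 := p.1.2
  simp only [sensitivity, waveguide, upperMode, Fin.val_rev]
  omega

lemma sensitivity_pos {N : ℕ} (p : MZI N) : 0 < sensitivity p := by
  rw [sensitivity_eq]
  exact Nat.succ_pos _

instance instIsProbabilityMeasureLawThetaSensitivity {N : ℕ} (p : MZI N) :
    IsProbabilityMeasure (lawTheta (sensitivity p)) :=
  isProbabilityMeasure_lawTheta (sensitivity_pos p)

instance instIsProbabilityMeasureLawTSensitivity {N : ℕ} (p : MZI N) :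
    IsProbabilityMeasure (lawT (sensitivity p)) :=
  isProbabilityMeasure_lawT (sensitivity_pos p)

instance instIsProbabilityMeasureProductLaw (N : ℕ) :
    IsProbabilityMeasure (productLaw N lawTheta) := by
  unfold productLaw; infer_instance

lemma measurePreserving_topLayer_subMesh (N : ℕ) :
    MeasurePreserving (fun q : Params (N + 1) => (topLayer q, subMesh q))
      (productLaw (N + 1) lawTheta) ((layerLaw N).prod (productLaw N lawTheta)) := by
  have hA := measurePreserving_pi_split (mziEquiv N) fun p => lawTheta (sensitivity p)
  have hB := measurePreserving_pi_split (mziEquiv N) fun _ => uniformPhase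
  have hC := measurePreserving_pi_zero fun _ : Fin (N + 1) => uniformPhase
  have h1 : (fun k : Fin N => lawTheta (sensitivity (mziEquiv N (Sum.inl k))))
      = fun k : Fin N => lawTheta (k + 1) := by
    funext k
    rw [sensitivity_eq]
    rfl
  have h2 : (fun p : MZI N => lawTheta (sensitivity (mziEquiv N (Sum.inr p))))
      = fun p : MZI N => lawTheta (sensitivity p) := by
    funext p
    rw [sensitivity_eq, sensitivity_eq]
    rfl
  rw [h1, h2] at hA
  have h := (measurePreserving_prodProdProdComm _ _ _ _).comp (hA.prod hB)
  exact (measurePreserving_prodProdProdComm _ _ _ _).comp (hC.prod h)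

lemma measurable_mesh {N : ℕ} : Measurable (mesh (N := N)) := continuous_mesh.measurable

/-- The image of the product law under the mesh is Haar measure. -/
lemma map_mesh (N : ℕ) : (productLaw N lawTheta).map mesh = haarU N := by
  induction N with
  | zero =>
    -- The group `U(0)` is trivial, so two probability measures on it coincide.
    have : IsProbabilityMeasure ((productLaw 0 lawTheta).map (mesh (N := 0))) :=
      Measure.isProbabilityMeasure_map measurable_mesh.aemeasurable
    refine Measure.ext fun s _ => ?_
    refine Subsingleton.set_cases ?_ ?_ s
    · simp
    · rw [measure_univ, measure_univ]
  | succ N ih =>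
    refine Measure.ext_of_lintegral _ fun f hf => ?_
    have hmp := measurePreserving_topLayer_subMesh N
    have hm : Measurable fun p : LayerParams N × Params N =>
        f (layerUnitary p.1 * embedUnitary (mesh p.2)) :=
      hf.comp ((measurable_layerUnitary.comp measurable_fst).mul
        (measurable_embedUnitary.comp (measurable_mesh.comp measurable_snd)))
    rw [lintegral_haarU_succ hf, lintegral_map hf measurable_mesh]
    simp only [mesh_succ]
    rw [hmp.lintegral_comp hm, lintegral_prod _ hm.aemeasurable]
    refine lintegral_congr fun l => ?_
    have hl : Measurable fun V : UnitaryN N => f (layerUnitary l * embedUnitary V) :=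
      hf.comp (measurable_embedUnitary.const_mul _)
    rw [← ih, lintegral_map hl measurable_mesh]

/-! ### Coordinates of a Haar random unitary -/

lemma measurable_mapInternal {N : ℕ} {f : ℕ → ℝ → ℝ} (hf : ∀ α, Measurable (f α)) :
    Measurable (mapInternal (N := N) f) := by
  unfold mapInternal
  fun_prop

lemma map_mapInternal {N : ℕ} {ν ν' : ℕ → Measure ℝ} {f : ℕ → ℝ → ℝ} (hf : ∀ α, Measurable (f α))
    [∀ p : MZI N, IsProbabilityMeasure (ν (sensitivity p))]
    (h : ∀ α, 0 < α → (ν α).map (f α) = ν' α) :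
    (productLaw N ν).map (mapInternal f) = productLaw N ν' := by
  have hp : ∀ p : MZI N, IsProbabilityMeasure ((ν (sensitivity p)).map (f (sensitivity p))) :=
    fun p => Measure.isProbabilityMeasure_map (hf _).aemeasurable
  have hpi : (Measure.pi fun p : MZI N => ν (sensitivity p)).map
      (fun x p => f (sensitivity p) (x p)) = Measure.pi fun p : MZI N => ν' (sensitivity p) := by
    rw [Measure.pi_map_pi fun p => (hf (sensitivity p)).aemeasurable]
    congr 1
    funext p
    exact h _ (sensitivity_pos p)
  have hm : Measurable fun (x : MZI N → ℝ) p => f (sensitivity p) (x p) := by fun_prop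
  have hmp : MeasurePreserving (fun (x : MZI N → ℝ) p => f (sensitivity p) (x p))
      (Measure.pi fun p : MZI N => ν (sensitivity p))
      (Measure.pi fun p : MZI N => ν' (sensitivity p)) := ⟨hm, hpi⟩
  have hfin : IsProbabilityMeasure (Measure.pi fun p : MZI N => ν' (sensitivity p)) := by
    rw [← hpi]
    exact Measure.isProbabilityMeasure_map hm.aemeasurable
  exact ((MeasurePreserving.id (Measure.pi fun _ : Fin N => uniformPhase)).prod
    (hmp.prod (MeasurePreserving.id (Measure.pi fun _ : MZI N => uniformPhase)))).map_eq

lemma ae_productLaw (N : ℕ) : ∀ᵐ q ∂productLaw N lawTheta, q ∈ paramInterior N :=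
  ae_prod_and (ae_pi_mem fun _ => ae_uniformPhase) (ae_prod_and (ae_pi_mem fun _ => ae_lawTheta _)
    (ae_pi_mem fun _ => ae_uniformPhase))

lemma measurableSet_paramInterior (N : ℕ) : MeasurableSet (paramInterior N) := by
  refine MeasurableSet.inter (s₁ := {q : Params N | ∀ n, q.1 n ∈ Set.Ico 0 (2 * Real.pi)}) ?_
    (MeasurableSet.inter (s₁ := {q : Params N | ∀ p, q.2.1 p ∈ Set.Ioo 0 Real.pi})
      (s₂ := {q : Params N | ∀ p, q.2.2 p ∈ Set.Ico 0 (2 * Real.pi)}) ?_ ?_)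
  · exact measurableSet_setOfPred.mpr (Measurable.forall fun n =>
      measurableSet_setOfPred.mp (measurableSet_Ico.preimage (by fun_prop)))
  · exact measurableSet_setOfPred.mpr (Measurable.forall fun p =>
      measurableSet_setOfPred.mp (measurableSet_Ioo.preimage (by fun_prop)))
  · exact measurableSet_setOfPred.mpr (Measurable.forall fun p =>
      measurableSet_setOfPred.mp (measurableSet_Ico.preimage (by fun_prop)))

lemma mesh_injOn (N : ℕ) : Set.InjOn mesh (paramInterior N) := fun _ hq _ hq' h =>
  mesh_inj hq (paramInterior_subset N hq') h

instance instT2SpaceUnitaryN (N : ℕ) : T2Space (UnitaryN N) := by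
  have : T2Space (Matrix (Fin N) (Fin N) ℂ) := inferInstanceAs (T2Space (Fin N → Fin N → ℂ))
  exact inferInstanceAs (T2Space (Subtype _))

/-- Almost every unitary is realized by interior parameters. -/
lemma ae_haarU_mem_image (N : ℕ) : ∀ᵐ U ∂haarU N, U ∈ mesh '' paramInterior N := by
  have hmeas : MeasurableSet (mesh '' paramInterior N) :=
    (measurableSet_paramInterior N).image_of_measurable_injOn measurable_mesh (mesh_injOn N)
  rw [← map_mesh]
  refine (ae_map_iff measurable_mesh.aemeasurable hmeas).mpr ?_
  filter_upwards [ae_productLaw N] with q hq using ⟨q, hq, rfl⟩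

/-- `mesh_inj` needs only one of the two parameters to be interior, so uniqueness holds against the
whole closed domain. -/
lemma ae_haarU_existsUnique (N : ℕ) :
    ∀ᵐ U ∂haarU N, ∃! q, q ∈ paramDomain N ∧ mesh q = U := by
  filter_upwards [ae_haarU_mem_image N] with U hU
  obtain ⟨q, hq, rfl⟩ := hU
  exact ⟨q, ⟨paramInterior_subset N hq, rfl⟩, fun q' hq' => (mesh_inj hq hq'.1 hq'.2.symm).symm⟩

/-- Any choice of mesh coordinates is almost everywhere measurable and has the product law. -/
lemma map_coordinates {N : ℕ} {c : UnitaryN N → Params N}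
    (hc : ∀ᵐ U ∂haarU N, c U ∈ paramDomain N ∧ mesh (c U) = U) :
    AEMeasurable c (haarU N) ∧ (haarU N).map c = productLaw N lawTheta := by
  obtain ⟨g, hg, hgm⟩ := exists_measurable_leftInverse measurable_mesh
    (measurableSet_paramInterior N) (mesh_injOn N)
  -- No regularity of `c` is used: over an image of interior parameters the fibre in the domain is a
  -- single point, which leaves no choice.
  have hcg : c =ᵐ[haarU N] g := by
    filter_upwards [hc, ae_haarU_mem_image N] with U hU hU'
    obtain ⟨q, hq, rfl⟩ := hU'
    rw [hgm q hq]
    exact (mesh_inj hq hU.1 hU.2.symm).symm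
  refine ⟨⟨g, hg, hcg⟩, ?_⟩
  rw [Measure.map_congr hcg, ← map_mesh, Measure.map_map hg measurable_mesh]
  conv_rhs => rw [← Measure.map_id (μ := productLaw N lawTheta)]
  refine Measure.map_congr ?_
  filter_upwards [ae_productLaw N] with q hq using hgm q hq

/-! ### Cumulative distribution functions -/

lemma integral_densityT {α : ℕ} (hα : 0 < α) (t : ℝ) :
    ∫ s in (0 : ℝ)..t, densityT α s = t ^ α := by
  rw [intervalIntegral.integral_eq_sub_of_hasDerivAt (f := fun s => s ^ α) (f' := densityT α)
    (fun s _ => hasDerivAt_pow α s)]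
  · simp [hα.ne']
  · exact (Continuous.intervalIntegrable (by unfold densityT; fun_prop) _ _)

/-- The Haar phase decreases in `θ` and vanishes at `π`, so integrating its derivative from `θ` to
`π` recovers it as the upper tail of the law of `θ`. -/
lemma hasDerivAt_haarPhase {α : ℕ} (hα : 0 < α) (θ : ℝ) :
    HasDerivAt (haarPhase α) (-densityTheta α θ) θ := by
  refine ((hasDerivAt_transmissivity θ).pow α).congr_deriv ?_
  rw [densityTheta_eq hα, densityT]
  ring

lemma haarPhase_pi {α : ℕ} (hα : 0 < α) : haarPhase α Real.pi = 0 := by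
  simp [haarPhase, transmissivity, hα.ne']

lemma integral_densityTheta {α : ℕ} (hα : 0 < α) (θ : ℝ) :
    ∫ s in θ..Real.pi, densityTheta α s = haarPhase α θ := by
  rw [intervalIntegral.integral_eq_sub_of_hasDerivAt (f := fun s => -haarPhase α s)
    (fun s _ => (hasDerivAt_haarPhase hα s).neg.congr_deriv (neg_neg _))]
  · simp [haarPhase_pi hα]
  · exact (Continuous.intervalIntegrable (by unfold densityTheta; fun_prop) _ _)

lemma haarPhase_eq_cos_pow (α : ℕ) (θ : ℝ) : haarPhase α θ = Real.cos (θ / 2) ^ (2 * α) := by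
  rw [haarPhase, transmissivity, ← pow_mul]

end

end TriangularMesh

open TriangularMesh MeasureTheory in
theorem mainTheorem3 (N : ℕ) :
    -- the mesh parametrizes `U(N)`, uniquely up to a null set
    (∀ U : UnitaryN N, ∃ q ∈ paramDomain N, mesh q = U) ∧
    (∀ᵐ U ∂haarU N, ∃! q, q ∈ paramDomain N ∧ mesh q = U) ∧
    -- the image of the product law, in phase and in transmissivity coordinates, is Haar measure
    Measurable (mesh (N := N)) ∧
    (productLaw N lawTheta).map mesh = haarU N ∧
    (productLaw N lawT).map
      (fun q => mesh (mapInternal (fun _ t => 2 * Real.arccos (Real.sqrt t)) q)) = haarU N ∧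
    -- the joint law of the mesh coordinates of a Haar random unitary
    (∀ c : UnitaryN N → Params N,
      (∀ᵐ U ∂haarU N, c U ∈ paramDomain N ∧ mesh (c U) = U) →
        AEMeasurable c (haarU N) ∧
        (haarU N).map c = productLaw N lawTheta ∧
        (haarU N).map (fun U => mapInternal (fun _ θ => transmissivity θ) (c U))
          = productLaw N lawT ∧
        (haarU N).map (fun U => mapInternal (fun _ θ => θ / 2) (c U))
          = productLaw N lawHalfTheta ∧
        (haarU N).map (fun U => mapInternal haarPhase (c U))
          = productLaw N (fun _ => uniformUnit)) ∧
    -- the Haar phase is the cumulative distribution function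
    (∀ p : MZI N,
      (∀ t ∈ Set.Icc (0 : ℝ) 1,
        (∫ s in (0 : ℝ)..t, densityT (sensitivity p) s) = t ^ sensitivity p) ∧
      (∀ θ ∈ Set.Icc (0 : ℝ) Real.pi,
        (∫ s in θ..Real.pi, densityTheta (sensitivity p) s) = haarPhase (sensitivity p) θ ∧
        haarPhase (sensitivity p) θ = Real.cos (θ / 2) ^ (2 * sensitivity p))) := by
  refine ⟨exists_mesh_eq, ae_haarU_existsUnique N, measurable_mesh, map_mesh N, ?_, ?_, ?_⟩
  -- The transmissivity form reduces to `map_mesh`, because `t ↦ 2 arccos √t` carries the law of `t`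
  -- to that of `θ`.
  · have hm : ∀ _ : ℕ, Measurable fun t : ℝ => 2 * Real.arccos (Real.sqrt t) := fun _ => by fun_prop
    have h := Measure.map_map (μ := productLaw N lawT) measurable_mesh
      (measurable_mapInternal (N := N) hm)
    rw [map_mapInternal hm fun α hα => map_two_arccos_lawT hα, map_mesh] at h
    exact h.symm
  · intro c hc
    obtain ⟨hcm, hmap⟩ := map_coordinates hc
    have key : ∀ (f : ℕ → ℝ → ℝ) (ν : ℕ → Measure ℝ), (∀ α, Measurable (f α)) →
        (∀ α, 0 < α → (lawTheta α).map (f α) = ν α) →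
        (haarU N).map (fun U => mapInternal f (c U)) = productLaw N ν := by
      intro f ν hf h
      have h1 := AEMeasurable.map_map_of_aemeasurable
        (measurable_mapInternal (N := N) hf).aemeasurable hcm
      rw [hmap, map_mapInternal hf h] at h1
      exact h1.symm
    exact ⟨hcm, hmap,
      key _ _ (fun _ => measurable_transmissivity) fun _ hα => map_transmissivity_lawTheta hα,
      key _ _ (fun _ => by fun_prop) fun α _ => map_half_lawTheta α,
      key _ _ (fun α => measurable_transmissivity.pow_const α) fun _ hα =>
        map_haarPhase_lawTheta hα⟩
  · exact fun p => ⟨fun t _ => integral_densityT (sensitivity_pos p) t, fun θ _ =>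
      ⟨integral_densityTheta (sensitivity_pos p) θ, haarPhase_eq_cos_pow _ θ⟩⟩
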